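/- Let $k$ be an algebraically closed field of characteristic $p>0$, let $\underline Z=\mathbb P(1,1,p)$ with homogeneous coordinates $z_0,z_1,z_2$ of weights $1,1,p$, let $\Delta_Z=(z_2=0)$ and $Z^\circ=\underline Z\smallsetminus\Delta_Z$, and let $\mathrm{str}_Z=[0:0:1]$. On $Z^\circ$ consider the functions $$U_i=\frac{z_0^{p-i}z_1^i}{z_2},\qquad i=0,1,\dots,p .$$ An $\mathbb A^1$-curve in $Z=(\underline Z,\Delta_Z)$ is a $k$-morphism $f\colon\mathbb P^1\to\underline Z$ with $f^{-1}(\Delta_Z)$ supported exactly at $\infty$ (equivalently, a non-constant proper $k$-morphism $\mathbb A^1\to Z^\circ$). Its contact order is $\deg f^*\Delta_Z$, the vanishing order at $\infty$ of the pullback of a local equation of $\Delta_Z$; its multiplicity at $\mathrm{str}_Z$ is the intersection number with the exceptional curve of its lift to the blow-up of $\underline Z$ at $\mathrm{str}_Z$, that is, the length of $f^{-1}(\mathrm{str}_Z)$. Let $\mathscr A_d(Z)$ be the moduli space of $\mathbb A^1$-curves in $Z$ of contact order $d$, up to automorphisms of $\mathbb P^1$ fixing $\infty$, with its Zariski topology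 (a set is closed iff its preimage in the base of every family of such curves is closed), and let $\mathscr A_{d,m}(Z)$ be the closure in $\mathscr A_d(Z)$ of the locus of curves with multiplicity $m$ at $\mathrm{str}_Z$. **Theorem 3.6.** Let $d>0$ and $0\le m\le d$ be integers with $m\equiv d \pmod p$. For every $\mathbb A^1$-curve $f$ in $\mathscr A_{d,m}(Z)$, with $t$ the standard coordinate on $\mathbb A^1$, there are $a_1,\dots,a_m\in k$ and $\beta_j,\gamma_j\in k$ $(0\le j\le \frac{d-m}{p})$ such that, with $$M(t)=\prod_{i=1}^m(t+a_i),\qquad V(t)=\sum_{j=0}^{(d-m)/p}\beta_j t^j,\qquad W(t)=\sum_{j=0}^{(d-m)/p}\gamma_j t^j$$ (and $M=1$ if $m=0$), one has $$f^*U_i=M(t)\,V(t)^{p-i}\,W(t)^i\qquad\text{for all } i=0,1,\dots,p .$$ -/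

import Mathlib

open CategoryTheory AlgebraicGeometry

universe u

namespace A1Z

noncomputable section

/-! ### Weighted projective spaces -/

/-- The grading of `k[x_0, …, x_{n-1}]` in which `x_i` has degree `w i`. -/
abbrev grading (k : Type u) [Field k] {n : ℕ} (w : Fin n → ℕ) :
    ℕ → Submodule k (MvPolynomial (Fin n) k) :=
  MvPolynomial.weightedHomogeneousSubmodule k w

instance instGradedAlgebraGrading (k : Type u) [Field k] {n : ℕ} (w : Fin n → ℕ) :
    GradedAlgebra (grading k w) :=
  MvPolynomial.weightedGradedAlgebra k w

theorem X_mem_grading (k : Type u) [Field k] {n : ℕ} (w : Fin n → ℕ) (i : Fin n) :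
    (MvPolynomial.X i : MvPolynomial (Fin n) k) ∈ grading k w (w i) :=
  MvPolynomial.isWeightedHomogeneous_X k w i

/-- The weighted projective space `ℙ(w_0, …, w_{n-1})` over `k`, as a scheme. -/
abbrev WProj (k : Type u) [Field k] {n : ℕ} (w : Fin n → ℕ) : Scheme.{u} :=
  Proj (grading k w)

/-- The structure morphism of a weighted projective space over `k`. -/
def WProj.toSpec (k : Type u) [Field k] {n : ℕ} (w : Fin n → ℕ) :
    WProj k w ⟶ Spec (CommRingCat.of k) :=
  Proj.toSpecZero (grading k w) ≫
    Spec.map (CommRingCat.ofHom (algebraMap k (grading k w 0)))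

/-- The standard chart `D₊(x_i)`, the locus where `x_i` does not vanish. -/
abbrev WProj.chart (k : Type u) [Field k] {n : ℕ} (w : Fin n → ℕ) (i : Fin n) :
    (WProj k w).Opens :=
  Proj.basicOpen (grading k w) (MvPolynomial.X i)

/-! ### The projective line with its marked point -/

abbrev lineWeight : Fin 2 → ℕ := fun _ => 1

/-- The projective line `ℙ¹ = Proj k[x_0, x_1]`. -/
abbrev Line (k : Type u) [Field k] : Scheme.{u} := WProj k lineWeight

abbrev Line.toSpec (k : Type u) [Field k] : Line k ⟶ Spec (CommRingCat.of k) :=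
  WProj.toSpec k lineWeight

/-- The affine line `𝔸¹ = ℙ¹ ∖ {∞} = D₊(x_1)`, where `∞ = [1 : 0]`. -/
abbrev affineLine (k : Type u) [Field k] : (Line k).Opens := WProj.chart k lineWeight 1

/-- The coordinate `t = x_0 / x_1` of the affine line, as a homogeneous fraction. -/
def coordFrac (k : Type u) [Field k] :
    HomogeneousLocalization.Away (grading k lineWeight) (MvPolynomial.X 1) :=
  HomogeneousLocalization.Away.mk (grading k lineWeight) (X_mem_grading k lineWeight 1) 1
    (MvPolynomial.X 0) (X_mem_grading k lineWeight 0)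

/-- The function `P(t)` on the affine line given by a polynomial `P`. This is the standard
isomorphism `k[t] ≅ Γ(𝔸¹, 𝒪)`. -/
def polyFun (k : Type u) [Field k] : Polynomial k →+* Γ(Line k, affineLine k) :=
  (Proj.awayToSection (grading k lineWeight) (MvPolynomial.X 1)).hom.comp
    (Polynomial.eval₂RingHom
      ((HomogeneousLocalization.fromZeroRingHom (grading k lineWeight) _).comp
        (algebraMap k (grading k lineWeight 0)))
      (coordFrac k))

/-! ### The pair `Z = (ℙ(1,1,p), (z_2 = 0))` -/

abbrev zWeight (p : ℕ) : Fin 3 → ℕ := ![1, 1, p]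

/-- The weighted projective plane `ℙ(1,1,p)`. -/
abbrev ZBar (k : Type u) [Field k] (p : ℕ) : Scheme.{u} := WProj k (zWeight p)

/-- The structure morphism of `ℙ(1,1,p)`. -/
abbrev ZBar.toSpec (k : Type u) [Field k] (p : ℕ) : ZBar k p ⟶ Spec (CommRingCat.of k) :=
  WProj.toSpec k (zWeight p)

/-- The complement `Z° = D₊(z_2)` of the boundary `Δ_Z = (z_2 = 0)`. -/
abbrev ZOpen (k : Type u) [Field k] (p : ℕ) : (ZBar k p).Opens := WProj.chart k (zWeight p) 2

theorem U_num_mem (k : Type u) [Field k] (p : ℕ) (i : Fin (p + 1)) :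
    (MvPolynomial.X 0 ^ (p - (i : ℕ)) * MvPolynomial.X 1 ^ (i : ℕ) : MvPolynomial (Fin 3) k) ∈
      grading k (zWeight p) (1 • zWeight p 2) := by
  have h := SetLike.mul_mem_graded (A := grading k (zWeight p))
    (SetLike.pow_mem_graded (p - (i : ℕ)) (X_mem_grading k (zWeight p) 0))
    (SetLike.pow_mem_graded (i : ℕ) (X_mem_grading k (zWeight p) 1))
  have e : (p - (i : ℕ)) • zWeight p 0 + (i : ℕ) • zWeight p 1 = 1 • zWeight p 2 := by
    have := i.is_lt
    simp only [zWeight, Matrix.cons_val_zero, Matrix.cons_val_one, Matrix.cons_val, smul_eq_mul]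
    omega
  rw [e] at h
  exact h

/-- The function `U_i = z_0^{p-i} z_1^i / z_2` on `Z°`. -/
def U (k : Type u) [Field k] (p : ℕ) (i : Fin (p + 1)) : Γ(ZBar k p, ZOpen k p) :=
  (Proj.awayToSection (grading k (zWeight p)) (MvPolynomial.X 2)).hom
    (HomogeneousLocalization.Away.mk (grading k (zWeight p)) (X_mem_grading k (zWeight p) 2) 1
      (MvPolynomial.X 0 ^ (p - (i : ℕ)) * MvPolynomial.X 1 ^ (i : ℕ)) (U_num_mem k p i))

/-- The ideal in `Γ(Z°, 𝒪)` of the singular point `str_Z = [0 : 0 : 1]`. It is generated by the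
functions `U_i`, which are the monomials generating the maximal ideal of that point. -/
def strIdeal (k : Type u) [Field k] (p : ℕ) : Ideal Γ(ZBar k p, ZOpen k p) :=
  Ideal.span (Set.range (U k p))

theorem boundary_num_mem (k : Type u) [Field k] (p : ℕ) (j : Fin 2) :
    (MvPolynomial.X 2 : MvPolynomial (Fin 3) k) ∈
      grading k (zWeight p) (p • zWeight p j.castSucc) := by
  have h := X_mem_grading k (zWeight p) 2
  fin_cases j <;> simpa [zWeight] using h

/-- The local equation `z_2 / z_j^p` of the boundary `Δ_Z` on the chart `D₊(z_j)`, for `j = 0, 1`.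
These two charts cover `Δ_Z`. -/
def boundaryEq (k : Type u) [Field k] (p : ℕ) (j : Fin 2) :
    Γ(ZBar k p, WProj.chart k (zWeight p) j.castSucc) :=
  (Proj.awayToSection (grading k (zWeight p)) (MvPolynomial.X j.castSucc)).hom
    (HomogeneousLocalization.Away.mk (grading k (zWeight p))
      (X_mem_grading k (zWeight p) j.castSucc) p (MvPolynomial.X 2) (boundary_num_mem k p j))

/-! ### 𝔸¹-curves in `Z` -/

/-- An `𝔸¹`-curve in `Z`: a `k`-morphism `f : ℙ¹ → ℙ(1,1,p)` such that `f⁻¹(Δ_Z)` is supported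
exactly at the marked point `∞`. Equivalently, `f` restricts to a non-constant proper morphism
`𝔸¹ → Z°`: were `f` constant, `f⁻¹(Δ_Z)` would be empty or all of `ℙ¹`. -/
@[ext]
structure Curve (k : Type u) [Field k] (p : ℕ) where
  /-- the underlying morphism -/
  hom : Line k ⟶ ZBar k p
  comp_toSpec : hom ≫ ZBar.toSpec k p = Line.toSpec k
  preimage : hom ⁻¹ᵁ ZOpen k p = affineLine k

/-- The pullback `f^* : Γ(Z°, 𝒪) → Γ(𝔸¹, 𝒪)` of functions. -/
def Curve.pullback {k : Type u} [Field k] {p : ℕ} (f : Curve k p) :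
    Γ(ZBar k p, ZOpen k p) →+* Γ(Line k, affineLine k) :=
  (f.hom.appLE (ZOpen k p) (affineLine k) f.preimage.ge).hom

/-- `f` has contact order `d` with `Δ_Z`: at the point `∞` of `ℙ¹` (the only point outside `𝔸¹`)
the pullback of the local equation of `Δ_Z` vanishes to order exactly `d`, that is, it generates
the `d`-th power of the maximal ideal of the discrete valuation ring `𝒪_{ℙ¹,∞}`. Since `f⁻¹(Δ_Z)`
is supported at `∞`, this number is `deg f^* Δ_Z`. -/
def Curve.HasContactOrder {k : Type u} [Field k] {p : ℕ} (f : Curve k p) (d : ℕ) : Prop :=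
  ∃ (x : Line k) (_ : x ∉ affineLine k) (j : Fin 2)
    (hj : x ∈ f.hom ⁻¹ᵁ WProj.chart k (zWeight p) j.castSucc),
    Ideal.span
        {(Line k).presheaf.germ (f.hom ⁻¹ᵁ WProj.chart k (zWeight p) j.castSucc) x hj
          (f.hom.app (WProj.chart k (zWeight p) j.castSucc) (boundaryEq k p j))} =
      IsLocalRing.maximalIdeal ((Line k).presheaf.stalk x) ^ d

/-- The multiplicity of `f` at `str_Z`: the length of the scheme-theoretic preimage `f⁻¹(str_Z)`.
If `g : ℙ¹ → H` is the lift of `f` to the blow-up `H → Z` at `str_Z` with exceptional curve `E_Z`,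
then `f⁻¹(str_Z) = g⁻¹(E_Z)`, so this is the intersection number `deg g^* E_Z`. -/
def Curve.multiplicity {k : Type u} [Field k] {p : ℕ} (f : Curve k p) : ℕ∞ :=
  Module.length Γ(Line k, affineLine k)
    (Γ(Line k, affineLine k) ⧸ (strIdeal k p).map f.pullback)

/-! ### Moduli of 𝔸¹-curves -/

/-- The `𝔸¹`-curves in `Z` of contact order `d`. -/
abbrev CurveOfOrder (k : Type u) [Field k] (p d : ℕ) : Type u :=
  {f : Curve k p // f.HasContactOrder d}

/-- Two `𝔸¹`-curves are isomorphic if they differ by an automorphism of `ℙ¹` over `k` that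
fixes `∞`, that is, preserves `𝔸¹`. -/
def curveSetoid (k : Type u) [Field k] (p d : ℕ) : Setoid (CurveOfOrder k p d) where
  r f g := ∃ s : Line k ≅ Line k, s.hom ≫ Line.toSpec k = Line.toSpec k ∧
    s.hom ⁻¹ᵁ affineLine k = affineLine k ∧ s.hom ≫ f.1.hom = g.1.hom
  iseqv :=
    { refl := fun f => ⟨Iso.refl _, by simp, by simp, by simp⟩
      symm := by
        rintro f g ⟨s, h1, h2, h3⟩
        refine ⟨s.symm, ?_, ?_, ?_⟩
        · simp [Iso.inv_comp_eq, h1]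
        · rw [Iso.symm_hom, ← h2, ← Scheme.Hom.comp_preimage, Iso.inv_hom_id,
            Scheme.Hom.id_preimage, h2]
        · simp [Iso.inv_comp_eq, h3]
      trans := by
        rintro f g h ⟨s, h1, h2, h3⟩ ⟨s', h1', h2', h3'⟩
        refine ⟨s' ≪≫ s, ?_, ?_, ?_⟩
        · simp [h1, h1']
        · rw [Iso.trans_hom, Scheme.Hom.comp_preimage, h2, h2']
        · simp [h3, h3'] }

/-- The (`k`-points of the) moduli space `𝒜_d(Z)` of `𝔸¹`-curves in `Z` of contact order `d`. -/
def Moduli (k : Type u) [Field k] (p d : ℕ) : Type u := Quotient (curveSetoid k p d)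

/-- The point of the moduli space given by an `𝔸¹`-curve. -/
def Moduli.mk {k : Type u} [Field k] {p d : ℕ} (f : CurveOfOrder k p d) : Moduli k p d :=
  Quotient.mk (curveSetoid k p d) f

/-- A family of `𝔸¹`-curves in `Z` over the affine `k`-scheme `Spec R` of finite type: a
`k`-morphism `F : ℙ¹ × Spec R → ℙ(1,1,p)` such that `F⁻¹(Δ_Z)` is supported exactly on the marked
section `∞ × Spec R`. (A family over a general base, with source a `ℙ¹`-bundle with a section, is
locally of this form, so these families determine the topology of the moduli space.) -/
structure Family (k : Type u) [Field k] (p : ℕ) where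
  /-- the coordinate ring of the base -/
  R : Type u
  [commRing : CommRing R]
  [algebra : Algebra k R]
  [finiteType : Algebra.FiniteType k R]
  /-- the total morphism -/
  hom : Limits.pullback (Line.toSpec k) (Spec.map (CommRingCat.ofHom (algebraMap k R))) ⟶ ZBar k p
  comp_toSpec : hom ≫ ZBar.toSpec k p = Limits.pullback.fst _ _ ≫ Line.toSpec k
  preimage : hom ⁻¹ᵁ ZOpen k p = (Limits.pullback.fst (Line.toSpec k)
    (Spec.map (CommRingCat.ofHom (algebraMap k R)))) ⁻¹ᵁ affineLine k

attribute [instance] Family.commRing Family.algebra Family.finiteType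

/-- The inclusion `ℙ¹ = ℙ¹ × {a} → ℙ¹ × Spec R` of the fibre over a `k`-point `a` of `Spec R`. -/
def Family.incl {k : Type u} [Field k] {p : ℕ} (F : Family k p) (a : F.R →ₐ[k] k) :
    Line k ⟶ Limits.pullback (Line.toSpec k)
      (Spec.map (CommRingCat.ofHom (algebraMap k F.R))) :=
  Limits.pullback.lift (𝟙 _) (Line.toSpec k ≫ Spec.map (CommRingCat.ofHom a.toRingHom)) (by
    rw [Category.assoc, ← Spec.map_comp, ← CommRingCat.ofHom_comp, AlgHom.toRingHom_eq_coe,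
      AlgHom.comp_algebraMap]
    simp [Algebra.algebraMap_self])

/-- The `𝔸¹`-curve parameterized by a `k`-point of the base of a family. -/
def Family.fibre {k : Type u} [Field k] {p : ℕ} (F : Family k p) (a : F.R →ₐ[k] k) :
    Curve k p where
  hom := F.incl a ≫ F.hom
  comp_toSpec := by
    rw [Category.assoc, F.comp_toSpec, Family.incl, Limits.pullback.lift_fst_assoc, Category.id_comp]
  preimage := by
    rw [Scheme.Hom.comp_preimage, F.preimage, ← Scheme.Hom.comp_preimage, Family.incl,
      Limits.pullback.lift_fst, Scheme.Hom.id_preimage]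

/-- The Zariski topology on the set of `k`-points of `Spec R`; the point of `Spec R` given by
`a : R →ₐ[k] k` is the kernel of `a`. -/
@[reducible]
def pointsTopology (k R : Type u) [Field k] [CommRing R] [Algebra k R] :
    TopologicalSpace (R →ₐ[k] k) :=
  TopologicalSpace.induced (fun a => PrimeSpectrum.comap a.toRingHom (⊥ : PrimeSpectrum k))
    inferInstance

/-- The Zariski topology of the moduli space `𝒜_d(Z)`: a set is closed exactly when, for every
family of `𝔸¹`-curves of contact order `d`, its preimage under the classifying map of the family
is Zariski closed in the base. -/
instance instTopologicalSpaceModuli (k : Type u) [Field k] (p d : ℕ) :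
    TopologicalSpace (Moduli k p d) :=
  ⨆ (F : Family k p) (hF : ∀ a : F.R →ₐ[k] k, (F.fibre a).HasContactOrder d),
    TopologicalSpace.coinduced (fun a => Moduli.mk ⟨F.fibre a, hF a⟩) (pointsTopology k F.R)

/-- The locus `𝒜°_{d,m}(Z)` in `𝒜_d(Z)` of `𝔸¹`-curves with multiplicity `m` at `str_Z`. -/
def openStratum (k : Type u) [Field k] (p d m : ℕ) : Set (Moduli k p d) :=
  {x | ∃ f : CurveOfOrder k p d, Moduli.mk f = x ∧ f.1.multiplicity = m}

/-- `𝒜_{d,m}(Z)`: the closure of `𝒜°_{d,m}(Z)` in `𝒜_d(Z)`. -/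
def stratum (k : Type u) [Field k] (p d m : ℕ) : Set (Moduli k p d) :=
  closure (openStratum k p d m)

end

end A1Z

/-! The polynomials `u_i = f^*U_i` inherit the binomial relations of the rational normal curve. As
`k[t]` is a PID, these relations force `u_i = M V^(p-i) W^i` with `V`, `W` coprime
(`exists_coprime_factorization`). The ideal of `f⁻¹(str_Z)` is then `(M)`, so `deg M` is the
multiplicity (`Curve.map_strIdeal`, `ord_polynomial`). The contact order `d` bounds every `deg u_i`,
with equality for `u_0` or `u_p` (`Curve.HasContactOrder.natDegree_poly`). Hence a curve of
multiplicity exactly `m` satisfies `HasForm p m ((d - m) / p)`.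

To pass to the closure, `HasForm` keeps only upper bounds on degrees and drops coprimality, which
makes it a closed condition on the base of any family (`Family.isClosed_hasForm`). This is a
valuative argument: a point in the closure is a specialization of a field-valued point where the
form holds. A valuation ring dominates the specialization, `M` and the pair `(V, W)` are scaled to
be primitive over it and reduced, and the Nullstellensatz brings the result from the residue field
back to `k`. The condition is also invariant under reparametrization, so it cuts out a closed subset
of the moduli space containing the open stratum.

At a limit curve, `u_0` or `u_p` still has degree `d`, which forces `deg M = m`. A `p`-th root of
the leading coefficient of `M` is absorbed into `V` and `W` (`HasForm.eq_prod`). -/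

namespace A1Z

open Polynomial

/-! ### Polynomial points of the cone over the rational normal curve -/

section RationalNormalCurve

variable {K : Type*} [Field K]

/-- The polynomials `u 0, …, u p` have the form `M V ^ (p - i) W ^ i` with `deg M ≤ m` and
`deg V, deg W ≤ e`. -/
def HasForm {A : Type*} [CommSemiring A] (p m e : ℕ) (u : ℕ → A[X]) : Prop :=
  ∃ M V W : A[X], M.natDegree ≤ m ∧ V.natDegree ≤ e ∧ W.natDegree ≤ e ∧
    ∀ i ≤ p, u i = M * V ^ (p - i) * W ^ i

/-- Polynomials satisfying the equations of the rational normal curve are, up to a common factor,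
the monomials of degree `p` in two coprime polynomials. -/
theorem exists_coprime_factorization {p : ℕ} (hp : 0 < p) (u : ℕ → K[X])
    (h1 : ∀ i < p, u i * u 1 = u (i + 1) * u 0)
    (h2 : ∀ i ≤ p, u i ^ p = u 0 ^ (p - i) * u p ^ i) :
    ∃ M V W : K[X], IsCoprime V W ∧ ∀ i ≤ p, u i = M * V ^ (p - i) * W ^ i := by
  classical
  by_cases h0 : u 0 = 0
  -- The `p`-th power relations kill every `u i` with `i < p`; at `i = p` the convention `0 ^ 0 = 1`
  -- leaves `u p`.
  · refine ⟨u p, 0, 1, isCoprime_one_right, fun i hi => ?_⟩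
    rcases hi.lt_or_eq with h | rfl
    · have := h2 i hi
      rw [h0, zero_pow (by omega), zero_mul] at this
      rw [zero_pow (by omega), mul_zero, zero_mul]
      exact pow_eq_zero_iff (by omega) |>.mp this
    · simp
  · obtain ⟨g, V, W, hVW, hV, hW⟩ : ∃ g V W, IsCoprime V W ∧ u 0 = g * V ∧ u 1 = g * W := by
      let := EuclideanDomain.gcdMonoid K[X]
      have hg : GCDMonoid.gcd (u 1) (u 0) ≠ 0 := fun h => h0 ((gcd_eq_zero_iff _ _).mp h).2
      exact ⟨GCDMonoid.gcd (u 1) (u 0), _, _, (isCoprime_div_gcd_div_gcd h0).symm,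
        (EuclideanDomain.mul_div_cancel' hg (gcd_dvd_right _ _)).symm,
        (EuclideanDomain.mul_div_cancel' hg (gcd_dvd_left _ _)).symm⟩
    have hV0 : V ≠ 0 := by rintro rfl; exact h0 (by simpa using hV)
    -- All ratios `u (i + 1) / u i` equal `u 1 / u 0 = W / V`.
    have key : ∀ i ≤ p, u i * V ^ i = u 0 * W ^ i := by
      intro i
      induction i with
      | zero => intro _; simp
      | succ i ih =>
        intro hi
        have := ih (by omega)
        have h3 := h1 i (by omega)
        apply mul_right_cancel₀ h0
        calc u (i + 1) * V ^ (i + 1) * u 0 = (u (i + 1) * u 0) * V ^ i * V := by ring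
          _ = (u i * V ^ i) * (u 1 * V) := by rw [← h3]; ring
          _ = u 0 * W ^ i * (g * V * W) := by rw [this, hW]; ring
          _ = u 0 * W ^ (i + 1) * u 0 := by rw [← hV]; ring
    -- The case `i = p` of `key` shows that `V ^ p` divides `u 0 * W ^ p`, and it is coprime to `W ^
    -- p`.
    obtain ⟨M, hM⟩ : V ^ p ∣ u 0 :=
      (hVW.pow (m := p) (n := p)).dvd_of_dvd_mul_right ⟨u p, by rw [← key p le_rfl, mul_comm]⟩
    refine ⟨M, V, W, hVW, fun i hi => ?_⟩
    apply mul_right_cancel₀ (pow_ne_zero i hV0)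
    rw [key i hi, hM]
    calc V ^ p * M * W ^ i = V ^ (p - i + i) * M * W ^ i := by rw [Nat.sub_add_cancel hi]
      _ = _ := by ring

theorem natDegree_le_of_natDegree_mul_pow_le {p d : ℕ} (hp : 0 < p) {M V : K[X]} (hM : M ≠ 0)
    (h : (M * V ^ p).natDegree ≤ d) : V.natDegree ≤ (d - M.natDegree) / p := by
  by_cases hV : V = 0
  · simp [hV]
  · rw [natDegree_mul hM (pow_ne_zero _ hV), natDegree_pow] at h
    rw [Nat.le_div_iff_mul_le hp, mul_comm]
    omega

theorem exists_prod_X_add_C_of_card {m : ℕ} {s : Multiset K} (hs : s.card = m) :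
    ∃ a : Fin m → K, (s.map fun a => X - C a).prod = ∏ l, (X + C (a l)) := by
  subst hs
  refine ⟨fun l => - s.toList.get (l.cast (Multiset.length_toList s).symm), ?_⟩
  rw [← (finCongr (Multiset.length_toList s)).prod_comp]
  conv_lhs => rw [← Multiset.coe_toList s, Multiset.map_coe, Multiset.prod_coe,
    ← List.ofFn_get s.toList, List.map_ofFn, List.prod_ofFn]
  exact Finset.prod_congr rfl fun l _ => by simp [sub_eq_add_neg]

/-- The hypothesis `hu` makes the degree bounds sharp: `d ≤ deg M + p * ((d - m) / p)` leaves no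
room for `deg M < m`. So `M` has exactly `m` roots, and only its leading coefficient has to be
removed. -/
theorem HasForm.eq_prod [IsAlgClosed K] {p d m : ℕ} (hp : 0 < p) (hd : 0 < d) (hmd : m ≤ d)
    (hmod : m ≡ d [MOD p]) {u : ℕ → K[X]} (h : HasForm p m ((d - m) / p) u)
    (hu : (u 0).natDegree = d ∨ (u p).natDegree = d) :
    ∃ (a : Fin m → K) (β γ : Fin ((d - m) / p + 1) → K), ∀ i ≤ p,
      u i = (∏ l, (X + C (a l))) * (∑ j, C (β j) * X ^ (j : ℕ)) ^ (p - i) *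
        (∑ j, C (γ j) * X ^ (j : ℕ)) ^ i := by
  obtain ⟨M, V, W, hM, hV, hW, huM⟩ := h
  have hdiv : p * ((d - m) / p) = d - m :=
    Nat.mul_div_cancel' ((Nat.modEq_iff_dvd' hmd).mp hmod)
  have aux : ∀ V : K[X], V.natDegree ≤ (d - m) / p → (M * V ^ p).natDegree = d →
      M.natDegree = m := by
    intro V hV h
    have h1 : (M * V ^ p).natDegree ≤ M.natDegree + p * V.natDegree :=
      natDegree_mul_le.trans (by simp)
    have h2 : p * V.natDegree ≤ d - m := hdiv ▸ Nat.mul_le_mul_left p hV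
    omega
  have hMm : M.natDegree = m := by
    rcases hu with h | h
    · exact aux V hV (by simpa [huM] using h)
    · exact aux W hW (by simpa [huM] using h)
  have hM0 : M ≠ 0 := by
    rintro rfl
    rcases hu with h | h <;> simp [huM] at h <;> omega
  -- Since `r ^ p = r ^ (p - i) * r ^ i`, replacing `V`, `W` by `r V`, `r W` absorbs the leading
  -- coefficient for all `i` at once.
  obtain ⟨r, hr⟩ := IsAlgClosed.exists_pow_nat_eq M.leadingCoeff hp
  have hroots : M = C M.leadingCoeff * (M.roots.map fun a => X - C a).prod :=
    (C_leadingCoeff_mul_prod_multiset_X_sub_C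
      (splits_iff_card_roots.mp (IsAlgClosed.splits M))).symm
  obtain ⟨a, ha⟩ := exists_prod_X_add_C_of_card (s := M.roots)
    ((splits_iff_card_roots.mp (IsAlgClosed.splits M)).trans hMm)
  have hsum : ∀ V : K[X], V.natDegree ≤ (d - m) / p →
      C r * V = ∑ j : Fin ((d - m) / p + 1), C ((C r * V).coeff j) * X ^ (j : ℕ) := by
    intro V hV
    conv_lhs => rw [as_sum_range_C_mul_X_pow' (C r * V) (n := (d - m) / p + 1)
      (Nat.lt_succ_of_le ((natDegree_C_mul_le _ _).trans hV))]
    rw [Finset.sum_range]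
  refine ⟨a, fun j => (C r * V).coeff j, fun j => (C r * W).coeff j, fun i hi => ?_⟩
  rw [← ha, ← hsum V hV, ← hsum W hW, huM i hi]
  conv_lhs => rw [hroots, ← hr]
  calc _ = C (r ^ (p - i + i)) * (M.roots.map fun a => X - C a).prod * V ^ (p - i) * W ^ i := by
        rw [Nat.sub_add_cancel hi]
    _ = _ := by rw [pow_add, C_mul, C_pow, C_pow]; ring

theorem HasForm.comp {p m e : ℕ} {u : ℕ → K[X]} (h : HasForm p m e u) {q : K[X]}
    (hq : q.natDegree ≤ 1) : HasForm p m e (fun i => (u i).comp q) := by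
  obtain ⟨M, V, W, hM, hV, hW, hu⟩ := h
  have aux : ∀ (P : K[X]), (P.comp q).natDegree ≤ P.natDegree := fun P =>
    natDegree_comp_le.trans (by nlinarith)
  exact ⟨M.comp q, V.comp q, W.comp q, (aux M).trans hM, (aux V).trans hV, (aux W).trans hW,
    fun i hi => by simp [hu i hi]⟩

theorem HasForm.map {A B : Type*} [CommSemiring A] [CommSemiring B] {p m e : ℕ} {u : ℕ → A[X]}
    (h : HasForm p m e u) (φ : A →+* B) : HasForm p m e (fun i => (u i).map φ) := by
  obtain ⟨M, V, W, hM, hV, hW, hu⟩ := h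
  exact ⟨M.map φ, V.map φ, W.map φ, natDegree_map_le.trans hM, natDegree_map_le.trans hV,
    natDegree_map_le.trans hW, fun i hi => by simp [hu i hi]⟩

theorem HasForm.congr {A : Type*} [CommSemiring A] {p m e : ℕ} {u v : ℕ → A[X]}
    (h : HasForm p m e u) (huv : ∀ i ≤ p, u i = v i) : HasForm p m e v := by
  obtain ⟨M, V, W, hM, hV, hW, hu⟩ := h
  exact ⟨M, V, W, hM, hV, hW, fun i hi => (huv i hi) ▸ hu i hi⟩

theorem HasForm.const_mul {A : Type*} [CommSemiring A] {p m e : ℕ} {u : ℕ → A[X]}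
    (h : HasForm p m e u) (c : A) : HasForm p m e (fun i => C c * u i) := by
  obtain ⟨M, V, W, hM, hV, hW, hu⟩ := h
  exact ⟨C c * M, V, W, (natDegree_C_mul_le _ _).trans hM, hV, hW,
    fun i hi => by simp only [hu i hi]; ring⟩

end RationalNormalCurve

/-! ### The form is stable under specialization -/

section Specialization

/-- Over a valuation ring, a finite family of elements of the fraction field can be scaled so that
it is primitive. -/
theorem exists_primitive_scaling {K ι : Type*} [Field K] [Finite ι] (A : ValuationSubring K)
    (c : ι → K) (hc : ∃ i, c i ≠ 0) :
    ∃ (r : K) (b : ι → A), (∀ i, c i = r * b i) ∧ ∃ i, IsUnit (b i) := by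
  obtain ⟨i₁, hi₁⟩ := hc
  have : Nonempty ι := ⟨i₁⟩
  -- Dividing by a member of maximal valuation puts all of them in `A` and turns that one into `1`.
  obtain ⟨i₀, hi₀⟩ := Finite.exists_max (fun i => A.valuation (c i))
  have h0 : c i₀ ≠ 0 := by
    intro h
    have := hi₀ i₁
    simp [h] at this
    exact hi₁ this
  have hmem : ∀ i, c i / c i₀ ∈ A := fun i => by
    rw [← A.valuation_le_one_iff, map_div₀]
    exact div_le_one_of_le₀ (hi₀ i) zero_le
  refine ⟨c i₀, fun i => ⟨c i / c i₀, hmem i⟩, fun i => by field_simp, i₀, ?_⟩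
  convert isUnit_one
  exact Subtype.ext (div_self h0)

theorem exists_primitive_polynomials {K ι : Type*} [Field K] [Finite ι] [Nonempty ι]
    (A : ValuationSubring K) (P : ι → K[X]) :
    ∃ (r : K) (Q : ι → A[X]), (∀ i, P i = C r * (Q i).map A.subtype) ∧
      (∀ i, (Q i).natDegree ≤ (P i).natDegree) ∧
      ∃ i, (Q i).map (IsLocalRing.residue A) ≠ 0 := by
  by_cases hP : ∀ i, P i = 0
  -- Zero polynomials are written as `0 * 1`, so that the reduction is nonzero even here.
  · exact ⟨0, fun _ => 1, by simp [hP], by simp, Classical.arbitrary ι, by simp⟩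
  push Not at hP
  obtain ⟨i₁, hi₁⟩ := hP
  obtain ⟨r, b, hb, ⟨i₀, j₀⟩, hu⟩ := exists_primitive_scaling A
    (fun x : (i : ι) × Fin ((P i).natDegree + 1) => (P x.1).coeff x.2)
    ⟨⟨i₁, Fin.last _⟩, by simpa using hi₁⟩
  have hco : ∀ i n, (∑ j : Fin ((P i).natDegree + 1), C (b ⟨i, j⟩) * X ^ (j : ℕ) : A[X]).coeff n =
      if h : n < (P i).natDegree + 1 then b ⟨i, ⟨n, h⟩⟩ else 0 := by
    intro i n
    simp only [finsetSum_coeff, coeff_C_mul_X_pow]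
    split_ifs with h
    · rw [Finset.sum_eq_single ⟨n, h⟩]
      · simp
      · intro j _ hj
        rw [if_neg]
        rintro rfl
        exact hj rfl
      · simp
    · refine Finset.sum_eq_zero fun j _ => if_neg ?_
      have := j.2
      omega
  refine ⟨r, fun i => ∑ j : Fin ((P i).natDegree + 1), C (b ⟨i, j⟩) * X ^ (j : ℕ), fun i => ?_,
    fun i => ?_, i₀, fun h => ?_⟩
  · ext n
    rw [coeff_C_mul, coeff_map, hco]
    split_ifs with h
    · exact hb ⟨i, ⟨n, h⟩⟩
    · simp only [map_zero, mul_zero]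
      exact coeff_eq_zero_of_natDegree_lt (by omega)
  · rw [natDegree_le_iff_coeff_eq_zero]
    intro n hn
    rw [hco, dif_neg (by omega)]
  · have := congrArg (fun Q => Q.coeff j₀) h
    simp only [coeff_map, hco, dif_pos j₀.2, coeff_zero] at this
    exact (hu.map (IsLocalRing.residue A)).ne_zero this

/-- The reduction of a family of polynomials over a valuation ring which has the form
`M V ^ (p - i) W ^ i` over the fraction field has that form over the residue field. -/
theorem HasForm.residue {K : Type*} [Field K] (A : ValuationSubring K) {p m e : ℕ} {u : ℕ → A[X]}
    (h : HasForm p m e fun i => (u i).map A.subtype) :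
    HasForm p m e fun i => (u i).map (IsLocalRing.residue A) := by
  obtain ⟨M, V, W, hM, hV, hW, hu⟩ := h
  beta_reduce at hu
  obtain ⟨r, M', hM', hMd, ⟨⟩, hM0⟩ := exists_primitive_polynomials A (fun _ : Unit => M)
  -- `V` and `W` must share one scalar: `V ^ (p - i) * W ^ i` then acquires the factor `s ^ p`,
  -- independent of `i`.
  obtain ⟨s, V', hV', hVd, j, hV0⟩ := exists_primitive_polynomials A ![V, W]
  have hinj : Function.Injective (Polynomial.map A.subtype) :=
    map_injective _ Subtype.val_injective
  have heq : ∀ i ≤ p, (u i).map A.subtype =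
      C (r * s ^ p) * (M' () * V' 0 ^ (p - i) * V' 1 ^ i).map A.subtype := by
    intro i hi
    have hV1 : V = _ := hV' 0
    have hW1 : W = _ := hV' 1
    rw [hu i hi, hM' (), hV1, hW1]
    calc _ = C (r * s ^ (p - i + i)) * (M' () * V' 0 ^ (p - i) * V' 1 ^ i).map A.subtype := by
          simp only [Polynomial.map_mul, Polynomial.map_pow, C_mul, C_pow]; ring
      _ = _ := by rw [Nat.sub_add_cancel hi]
  have hform : HasForm p m e fun i => M' () * V' 0 ^ (p - i) * V' 1 ^ i :=
    ⟨M' (), V' 0, V' 1, (hMd ()).trans hM, (hVd 0).trans hV, (hVd 1).trans hW, fun _ _ => rfl⟩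
  -- If the scalar is in `A`, it multiplies the primitive form. Otherwise its inverse is in `A`, and
  -- it can be divided out after reduction once its residue is known to be nonzero.
  rcases A.mem_or_inv_mem (r * s ^ p) with hc | hc
  · refine ((hform.const_mul ⟨_, hc⟩).congr fun i hi => hinj ?_).map _
    rw [heq i hi, Polynomial.map_mul, Polynomial.map_C]
    rfl
  · by_cases hc0 : r * s ^ p = 0
    · refine ((hform.const_mul 0).congr fun i hi => hinj ?_).map _
      rw [heq i hi, hc0]
      simp
    have heq' : ∀ i ≤ p, C (⟨_, hc⟩ : A) * u i = M' () * V' 0 ^ (p - i) * V' 1 ^ i := by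
      intro i hi
      apply hinj
      rw [Polynomial.map_mul, heq i hi, Polynomial.map_C, ← mul_assoc, ← C_mul]
      have : A.subtype ⟨_, hc⟩ * (r * s ^ p) = 1 := inv_mul_cancel₀ hc0
      rw [this, C_1, one_mul]
    set c := IsLocalRing.residue A ⟨_, hc⟩ with hcdef
    have heq'' : ∀ i ≤ p, C c * (u i).map (IsLocalRing.residue A) =
        (M' () * V' 0 ^ (p - i) * V' 1 ^ i).map (IsLocalRing.residue A) := by
      intro i hi
      rw [← heq' i hi, Polynomial.map_mul, Polynomial.map_C]
    -- A zero residue would kill the reduction of `M' V' ^ p` or of `M' W' ^ p`, according to which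
    -- of the pair has nonzero reduction.
    have hcne : c ≠ 0 := by
      intro h
      fin_cases j
      · have := heq'' 0 (Nat.zero_le _)
        simp only [h, Polynomial.map_mul, Polynomial.map_pow] at this
        simp [pow_eq_zero_iff', hM0] at this
        exact hV0 this.1
      · have := heq'' p le_rfl
        simp only [h, Polynomial.map_mul, Polynomial.map_pow] at this
        simp [pow_eq_zero_iff', hM0] at this
        exact hV0 this.1
    refine ((hform.map (IsLocalRing.residue A)).const_mul c⁻¹).congr fun i hi => ?_
    rw [← heq'' i hi, ← mul_assoc, ← C_mul, inv_mul_cancel₀ hcne, C_1, one_mul]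

/-- Weak Nullstellensatz: a residue field at a maximal ideal is finite over `k`, hence embeds in
`k`. -/
theorem exists_algHom_of_finiteType {k A : Type*} [Field k] [IsAlgClosed k] [CommRing A]
    [Algebra k A] [Algebra.FiniteType k A] [Nontrivial A] : Nonempty (A →ₐ[k] k) := by
  obtain ⟨I, hI⟩ := Ideal.exists_maximal A
  let := Ideal.Quotient.field I
  have : Module.Finite k (A ⧸ I) := finite_of_finite_type_of_isJacobsonRing k (A ⧸ I)
  exact ⟨(IsAlgClosed.lift (M := k) : (A ⧸ I) →ₐ[k] k).comp (Ideal.Quotient.mkₐ k I)⟩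

/-- The form `M V ^ (p - i) W ^ i` descends along extensions of an algebraically closed field. -/
theorem HasForm.descend {k L : Type*} [Field k] [IsAlgClosed k] [Field L] [Algebra k L]
    {p m e : ℕ} {u : ℕ → k[X]} (h : HasForm p m e fun i => (u i).map (algebraMap k L)) :
    HasForm p m e u := by
  classical
  obtain ⟨M, V, W, hM, hV, hW, hu⟩ := h
  -- The factorization is already defined over the finitely generated `k`-algebra `S` of
  -- coefficients; a `k`-point of `S` fixes `u`, whose coefficients lie in `k`.
  let S := Algebra.adjoin k ((M.coeffs ∪ V.coeffs ∪ W.coeffs : Finset L) : Set L)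
  have hS : ((M.coeffs ∪ V.coeffs ∪ W.coeffs : Finset L) : Set L) ⊆ S.toSubring :=
    Algebra.subset_adjoin
  have hMS : (M.coeffs : Set L) ⊆ S.toSubring := fun x hx => hS (by simp at hx ⊢; tauto)
  have hVS : (V.coeffs : Set L) ⊆ S.toSubring := fun x hx => hS (by simp at hx ⊢; tauto)
  have hWS : (W.coeffs : Set L) ⊆ S.toSubring := fun x hx => hS (by simp at hx ⊢; tauto)
  have : Algebra.FiniteType k S := (Subalgebra.fg_iff_finiteType S).mp ⟨_, rfl⟩
  obtain ⟨φ⟩ := exists_algHom_of_finiteType (k := k) (A := S)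
  have hform : HasForm p m e fun i => (u i).map (algebraMap k S) := by
    refine ⟨M.toSubring _ hMS, V.toSubring _ hVS, W.toSubring _ hWS, by rwa [natDegree_toSubring],
      by rwa [natDegree_toSubring], by rwa [natDegree_toSubring], fun i hi => ?_⟩
    apply map_injective S.toSubring.subtype Subtype.val_injective
    simp only [Polynomial.map_mul, Polynomial.map_pow, map_toSubring]
    rw [← hu i hi, Polynomial.map_map]
    rfl
  refine (hform.map φ.toRingHom).congr fun i _ => ?_
  rw [Polynomial.map_map, AlgHom.toRingHom_eq_coe, AlgHom.comp_algebraMap, Algebra.algebraMap_self,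
    Polynomial.map_id]

/-- The map `χ` extends to the local ring at `𝔪`, and every local ring mapping to a field is
dominated by a valuation ring of that field. -/
theorem exists_valuationSubring_dominating {R K : Type*} [CommRing R] [Field K] (χ : R →+* K)
    (𝔪 : Ideal R) [𝔪.IsPrime] (hχ : ∀ r ∉ 𝔪, χ r ≠ 0) :
    ∃ (A : ValuationSubring K) (η : R →+* A), A.subtype.comp η = χ ∧ ∀ r ∈ 𝔪, ¬ IsUnit (η r) := by
  have hunit : ∀ y : 𝔪.primeCompl, IsUnit (χ y) := fun y => isUnit_iff_ne_zero.mpr (hχ y y.2)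
  let ψ : Localization.AtPrime 𝔪 →+* K := IsLocalization.lift hunit
  obtain ⟨A, hA, hloc⟩ := IsLocalRing.exists_factor_valuationRing ψ
  refine ⟨A, (ψ.codRestrict A.toSubring hA).comp (algebraMap R _), ?_, fun r hr h => ?_⟩
  · ext r
    exact IsLocalization.lift_eq hunit r
  · have := (isUnit_map_iff (ψ.codRestrict A.toSubring hA) _).mp h
    rw [IsLocalization.AtPrime.isUnit_to_map_iff _ 𝔪] at this
    exact this hr

/-- The inclusion of `ker χ` in `ker a₀` says that `a₀` specializes `χ`. In a dominating valuation
ring, each `r` and the constant `a₀ r` have the same residue, so reduction computes the fibre at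
`a₀`. -/
theorem HasForm.specialize {k R K : Type*} [Field k] [IsAlgClosed k] [CommRing R] [Algebra k R]
    [Field K] {p m e : ℕ} {u : ℕ → R[X]} (χ : R →+* K) (a₀ : R →ₐ[k] k)
    (hχ : ∀ r, χ r = 0 → a₀ r = 0) (h : HasForm p m e fun i => (u i).map χ) :
    HasForm p m e fun i => (u i).map a₀.toRingHom := by
  have : (RingHom.ker a₀).IsPrime := RingHom.ker_isPrime a₀
  obtain ⟨A, η, rfl, hnu⟩ := exists_valuationSubring_dominating χ (RingHom.ker a₀)
    fun r hr h => hr (hχ r h)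
  have hres := HasForm.residue A (u := fun i => (u i).map η)
    (h.congr fun i _ => (Polynomial.map_map _ _ _).symm)
  let : Algebra k (IsLocalRing.ResidueField A) :=
    ((IsLocalRing.residue A).comp (η.comp (algebraMap k R))).toAlgebra
  refine HasForm.descend (L := IsLocalRing.ResidueField A) (hres.congr fun i _ => ?_)
  rw [Polynomial.map_map, Polynomial.map_map]
  congr 1
  ext r
  have hr : algebraMap k R (a₀ r) - r ∈ RingHom.ker a₀ := by
    rw [RingHom.mem_ker, map_sub, AlgHom.commutes]
    simp
  have := (IsLocalRing.residue_eq_zero_iff _).mpr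
    ((IsLocalRing.mem_maximalIdeal _).mpr (hnu _ hr))
  rw [map_sub, map_sub, sub_eq_zero] at this
  exact this.symm

/-- The degree bounds are uniform, so pointwise witnesses assemble coefficientwise into polynomials
over the product ring. -/
theorem HasForm.pi {k ι : Type*} [CommRing k] {p m e : ℕ} {u : ℕ → (ι → k)[X]}
    (h : ∀ a, HasForm p m e fun i => (u i).map (Pi.evalRingHom _ a)) : HasForm p m e u := by
  choose M V W hM hV hW hu using h
  have key : ∀ (P : ι → k[X]) (n : ℕ), (∀ a, (P a).natDegree ≤ n) →
      ∃ Q : (ι → k)[X], Q.natDegree ≤ n ∧ ∀ a, Q.map (Pi.evalRingHom _ a) = P a := by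
    intro P n hP
    refine ⟨∑ j ∈ Finset.range (n + 1), C (fun a => (P a).coeff j) * X ^ j, ?_, fun a => ?_⟩
    · exact natDegree_sum_le_of_forall_le _ _ fun j hj =>
        (natDegree_C_mul_X_pow_le _ _).trans (by simpa [Nat.lt_succ_iff] using hj)
    · rw [Polynomial.map_sum]
      simp only [Polynomial.map_mul, Polynomial.map_C, Polynomial.map_pow, Polynomial.map_X,
        Pi.evalRingHom_apply]
      exact (as_sum_range_C_mul_X_pow' _ (Nat.lt_succ_of_le (hP a))).symm
  obtain ⟨M', hM', hMe⟩ := key M m hM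
  obtain ⟨V', hV', hVe⟩ := key V e hV
  obtain ⟨W', hW', hWe⟩ := key W e hW
  refine ⟨M', V', W', hM', hV', hW', fun i hi => ?_⟩
  have hext : ∀ P Q : (ι → k)[X],
      (∀ a, P.map (Pi.evalRingHom _ a) = Q.map (Pi.evalRingHom _ a)) → P = Q := by
    intro P Q h
    ext n a
    simpa using congrArg (fun Q => Q.coeff n) (h a)
  refine hext _ _ fun a => ?_
  simp only [Polynomial.map_mul, Polynomial.map_pow, hMe, hVe, hWe]
  exact hu a i hi

/-- The form `M V ^ (p - i) W ^ i` is a closed condition on the points of a family. -/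
theorem HasForm.of_mem_closure {k R : Type*} [Field k] [IsAlgClosed k] [CommRing R] [Algebra k R]
    {p m e : ℕ} {u : ℕ → R[X]} {S : Set (R →ₐ[k] k)}
    (hS : ∀ a ∈ S, HasForm p m e fun i => (u i).map a.toRingHom) {a₀ : R →ₐ[k] k}
    (ha₀ : ∀ r : R, (∀ a ∈ S, a r = 0) → a₀ r = 0) :
    HasForm p m e fun i => (u i).map a₀.toRingHom := by
  let ρ : R →+* (S → k) := RingHom.pi fun a => a.1.toRingHom
  have : (RingHom.ker a₀).IsPrime := RingHom.ker_isPrime a₀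
  -- A prime of the product that avoids the images of all `r` with `a₀ r ≠ 0` plays the role of a
  -- generic point of `S` specializing to `a₀`: the form holds in the product, hence in the fraction
  -- field modulo `q`.
  obtain ⟨q, hq, -, hdisj⟩ := Ideal.exists_le_prime_disjoint (⊥ : Ideal (S → k))
    ((RingHom.ker a₀).primeCompl.map ρ) (by
      rw [Set.disjoint_left]
      rintro _ h0 ⟨r, hr, rfl⟩
      exact hr (ha₀ r fun a ha => congrFun (h0 : ρ r = 0) ⟨a, ha⟩))
  have hB : HasForm p m e fun i => (u i).map ρ := by
    refine HasForm.pi fun a => (hS a a.2).congr fun i _ => ?_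
    rw [Polynomial.map_map]
    rfl
  refine HasForm.specialize (((algebraMap _ (FractionRing ((S → k) ⧸ q))).comp
    (Ideal.Quotient.mk q)).comp ρ) a₀ (fun r hr => ?_)
    ((hB.map ((algebraMap _ (FractionRing ((S → k) ⧸ q))).comp (Ideal.Quotient.mk q))).congr
      fun i _ => Polynomial.map_map _ _ _)
  by_contra h
  have h1 : Ideal.Quotient.mk q (ρ r) = 0 :=
    (map_eq_zero_iff _ (IsFractionRing.injective ((S → k) ⧸ q) _)).mp hr
  rw [Ideal.Quotient.eq_zero_iff_mem] at h1
  exact Set.disjoint_left.mp hdisj h1 ⟨r, h, rfl⟩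

end Specialization

open HomogeneousLocalization

/-! ### Coordinate rings of the charts of the projective line -/

noncomputable section Charts

variable (k : Type u) [Field k]

theorem le_preimage_top {X Y : Scheme.{u}} (f : X ⟶ Y) (V : X.Opens) : V ≤ f ⁻¹ᵁ ⊤ := le_top

theorem appLE_toSpecZero {n : ℕ} (w : Fin n → ℕ) {f : MvPolynomial (Fin n) k} {m : ℕ}
    (hf : f ∈ grading k w m) (hm : 0 < m) :
    (Proj.toSpecZero (grading k w)).appLE ⊤ (Proj.basicOpen (grading k w) f)
      (le_preimage_top _ _) =
      (Scheme.ΓSpecIso _).hom ≫ CommRingCat.ofHom (fromZeroRingHom (grading k w) _) ≫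
        Proj.awayToSection (grading k w) f := by
  have h1 : (Proj.basicOpen (grading k w) f).ι ≫ Proj.toSpecZero (grading k w) =
      Proj.basicOpenToSpec (grading k w) f ≫
        Spec.map (CommRingCat.ofHom (fromZeroRingHom (grading k w) _)) := by
    rw [← Proj.awayι_toSpecZero (grading k w) f hf hm, Proj.awayι, ← Proj.basicOpenIsoSpec_hom _ _ hf hm,
      Category.assoc, Iso.hom_inv_id_assoc]
  have h2 := congrArg (fun g => Scheme.Hom.appTop g ≫ (Proj.basicOpen (grading k w) f).topIso.hom) h1
  simp only [Scheme.Hom.comp_appTop, Category.assoc] at h2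
  rw [Scheme.Hom.appTop, Scheme.Hom.appTop, Scheme.Hom.appTop, Scheme.Hom.appTop,
    Proj.basicOpenToSpec_app_top] at h2
  simp only [Category.assoc, Iso.inv_hom_id, Category.comp_id] at h2
  rw [← Scheme.ΓSpecIso_naturality_assoc, Scheme.Hom.appTop, ← h2]
  change (Proj.toSpecZero (grading k w)).app ⊤ ≫ _ = (Proj.toSpecZero (grading k w)).app ⊤ ≫ _
  congr 1

/-- The fraction `x_j / x_i` on the chart `D₊(x_i)` of the projective line. -/
def lineFrac (i j : Fin 2) : Away (grading k lineWeight) (MvPolynomial.X i) :=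
  Away.mk (grading k lineWeight) (X_mem_grading k lineWeight i) 1
    (MvPolynomial.X j) (X_mem_grading k lineWeight j)

/-- Polynomials in `x_j / x_i` as homogeneous fractions. -/
def linePoly (i j : Fin 2) : k[X] →+* Away (grading k lineWeight) (MvPolynomial.X i) :=
  eval₂RingHom ((fromZeroRingHom (grading k lineWeight) _).comp
    (algebraMap k (grading k lineWeight 0))) (lineFrac k i j)

theorem linePoly_X (i j : Fin 2) : linePoly k i j X = lineFrac k i j := by
  simp [linePoly]

theorem linePoly_C (i j : Fin 2) (c : k) : linePoly k i j (C c) =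
    fromZeroRingHom (grading k lineWeight) _ (algebraMap k (grading k lineWeight 0) c) := by
  simp [linePoly]

theorem val_linePoly_C (i j : Fin 2) (c : k) : (linePoly k i j (C c)).val =
    algebraMap (MvPolynomial (Fin 2) k) _ (MvPolynomial.C c) := by
  rw [linePoly_C]
  rfl

theorem val_linePoly_X (i j : Fin 2) : (linePoly k i j X).val *
    algebraMap (MvPolynomial (Fin 2) k) _ (MvPolynomial.X i) =
    algebraMap (MvPolynomial (Fin 2) k) _ (MvPolynomial.X j) := by
  have h := IsLocalization.mk'_spec
    (Localization (Submonoid.powers (MvPolynomial.X i : MvPolynomial (Fin 2) k)))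
    (MvPolynomial.X j : MvPolynomial (Fin 2) k)
    (⟨MvPolynomial.X i ^ 1, ⟨1, rfl⟩⟩ : Submonoid.powers (MvPolynomial.X i : MvPolynomial (Fin 2) k))
  rw [linePoly_X, lineFrac, Away.val_mk, Localization.mk_eq_mk']
  simpa only [pow_one] using h

/-- Dehomogenizing by `x_i ↦ 1`, `x_j ↦ X` is a left inverse. -/
theorem linePoly_injective {i j : Fin 2} (hij : i ≠ j) : Function.Injective (linePoly k i j) := by
  let ev : MvPolynomial (Fin 2) k →+* k[X] :=
    MvPolynomial.eval₂Hom C (fun l => if l = i then 1 else X)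
  let L : Localization.Away (MvPolynomial.X i : MvPolynomial (Fin 2) k) →+* k[X] :=
    IsLocalization.Away.lift (x := MvPolynomial.X i) (g := ev) (by simp [ev])
  have hL : ∀ a, L (algebraMap (MvPolynomial (Fin 2) k) _ a) = ev a := fun a =>
    IsLocalization.Away.lift_eq _ _ a
  let G : k[X] →+* k[X] := (L.comp (algebraMap _ _)).comp (linePoly k i j)
  have hG : G = RingHom.id _ := by
    refine Polynomial.ringHom_ext (fun c => ?_) ?_
    · simp [G, val_linePoly_C, hL, ev]
    · have := congrArg L (val_linePoly_X k i j)
      rw [map_mul, hL, hL] at this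
      simpa [G, ev, hij.symm] using this
  intro P Q h
  have : G P = G Q := by simp [G, h]
  simpa [hG] using this

theorem linePoly_surjective {i j : Fin 2} (hij : i ≠ j) : Function.Surjective (linePoly k i j) := by
  intro z
  obtain ⟨n, a, ha, rfl⟩ := Away.mk_surjective (grading k lineWeight) (X_mem_grading k lineWeight i) z
  refine ⟨∑ v ∈ a.support, C (a.coeff v) * X ^ (v j), ?_⟩
  apply val_injective
  rw [Away.val_mk, Localization.mk_eq_mk', IsLocalization.eq_mk'_iff_mul_eq]
  conv_rhs => rw [← a.support_sum_monomial_coeff]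
  rw [← HomogeneousLocalization.algebraMap_apply]
  rw [map_sum, map_sum, map_sum, Finset.sum_mul]
  refine Finset.sum_congr rfl fun v hv => ?_
  -- Homogeneity of the numerator makes each monomial over `x_i ^ n` a constant times `(x_j / x_i) ^
  -- v j`.
  have hw : v i + v j = n := by
    have := ha (MvPolynomial.mem_support_iff.mp hv)
    simp [Finsupp.weight_apply, Finsupp.sum_fintype] at this
    fin_cases i <;> fin_cases j <;> simp_all
    omega
  have hm : MvPolynomial.monomial v (a.coeff v) =
      MvPolynomial.C (a.coeff v) * MvPolynomial.X i ^ (v i) * MvPolynomial.X j ^ (v j) := by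
    rw [MvPolynomial.monomial_eq, Finsupp.prod_fintype _ _ (by simp), Fin.prod_univ_two]
    fin_cases i <;> fin_cases j <;> simp_all <;> ring
  have hX := val_linePoly_X k i j
  have hC := val_linePoly_C k i j (a.coeff v)
  rw [← HomogeneousLocalization.algebraMap_apply] at hX hC
  rw [hm, map_mul, map_mul, map_mul, map_mul, map_pow, map_pow, map_pow, map_pow, map_pow, ← hX, hC]
  simp only [← hw, pow_add, mul_pow]
  ring

end Charts

/-! ### Functions on the charts and their restrictions to overlaps -/

noncomputable section Sections

variable (k : Type u) [Field k]

theorem awayToSection_bijective {n : ℕ} (w : Fin n → ℕ) {f : MvPolynomial (Fin n) k} {m : ℕ}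
    (hf : f ∈ grading k w m) (hm : 0 < m) :
    Function.Bijective (Proj.awayToSection (grading k w) f).hom := by
  rw [← Proj.basicOpenIsoAway_hom (grading k w) f hf hm]
  exact (Proj.basicOpenIsoAway (grading k w) f hf hm).commRingCatIsoToRingEquiv.bijective

theorem basicOpen_awayToSection {n : ℕ} (w : Fin n → ℕ) {f g : MvPolynomial (Fin n) k}
    {m m' : ℕ} (hf : f ∈ grading k w m) (hm : 0 < m) (hg : g ∈ grading k w m') (hm' : 0 < m') :
    (WProj k w).basicOpen ((Proj.awayToSection (grading k w) f).hom (Away.isLocalizationElem hf hg)) =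
      Proj.basicOpen (grading k w) f ⊓ Proj.basicOpen (grading k w) g := by
  set U := Proj.basicOpen (grading k w) f with hU
  have h1 := Proj.awayι_preimage_basicOpen (grading k w) hf hm hg hm'
  have h2 : Proj.basicOpenToSpec (grading k w) f ⁻¹ᵁ PrimeSpectrum.basicOpen (Away.isLocalizationElem hf hg)
      = U.ι ⁻¹ᵁ Proj.basicOpen (grading k w) g := by
    rw [← h1, ← Scheme.Hom.comp_preimage, Proj.awayι, ← Proj.basicOpenIsoSpec_hom _ _ hf hm,
      Iso.hom_inv_id_assoc]
  have h3 : Proj.basicOpenToSpec (grading k w) f ⁻¹ᵁ PrimeSpectrum.basicOpen (Away.isLocalizationElem hf hg)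
      = U.ι ⁻¹ᵁ (WProj k w).basicOpen
        ((Proj.awayToSection (grading k w) f).hom (Away.isLocalizationElem hf hg)) := by
    rw [← Scheme.Opens.toSpecΓ_preimage_basicOpen]
    rfl
  rw [h3] at h2
  have h4 := congrArg (fun V => U.ι ''ᵁ V) h2
  simp only [Scheme.Hom.image_preimage_eq_opensRange_inf, Scheme.Opens.opensRange_ι] at h4
  rw [← h4]
  exact (inf_eq_right.mpr (Scheme.basicOpen_le _ _)).symm

/-- Restriction of a homogeneous fraction to a smaller standard open. -/
theorem res_awayToSection {n : ℕ} (w : Fin n → ℕ) {f g x : MvPolynomial (Fin n) k} {m : ℕ}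
    (hg : g ∈ grading k w m) (hx : x = f * g) (hle : Proj.basicOpen (grading k w) x ≤
      Proj.basicOpen (grading k w) f) (a : Away (grading k w) f) :
    (WProj k w).presheaf.map (homOfLE hle).op ((Proj.awayToSection (grading k w) f).hom a) =
      (Proj.awayToSection (grading k w) x).hom (awayMap (grading k w) hg hx a) :=
  (congr($(Proj.awayMap_awayToSection (grading k w) hg hx) a)).symm

theorem toSpec_appLE {n : ℕ} (w : Fin n → ℕ) {f : MvPolynomial (Fin n) k} {m : ℕ}
    (hf : f ∈ grading k w m) (hm : 0 < m) (c : k) :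
    (WProj.toSpec k w).appLE ⊤ (Proj.basicOpen (grading k w) f) (le_preimage_top _ _)
      ((Scheme.ΓSpecIso (CommRingCat.of k)).inv c) =
    (Proj.awayToSection (grading k w) f).hom (fromZeroRingHom (grading k w) _
      (algebraMap k (grading k w 0) c)) := by
  have : (WProj.toSpec k w).appLE ⊤ (Proj.basicOpen (grading k w) f) (le_preimage_top _ _) =
      (Scheme.ΓSpecIso (CommRingCat.of k)).hom ≫
        CommRingCat.ofHom (algebraMap k (grading k w 0)) ≫
        CommRingCat.ofHom (fromZeroRingHom (grading k w) _) ≫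
        Proj.awayToSection (grading k w) f := by
    rw [← Scheme.ΓSpecIso_naturality_assoc, ← appLE_toSpecZero k w hf hm]
    simp [WProj.toSpec, Scheme.Hom.comp_appLE]
  rw [this]
  simp

/-- Polynomials in `x_j / x_i` as functions on the chart `D₊(x_i)` of the projective line. -/
def chartFun (i j : Fin 2) : k[X] →+* Γ(Line k, WProj.chart k lineWeight i) :=
  (Proj.awayToSection (grading k lineWeight) (MvPolynomial.X i)).hom.comp (linePoly k i j)

theorem polyFun_eq : polyFun k = chartFun k 1 0 := rfl

theorem chartFun_bijective {i j : Fin 2} (hij : i ≠ j) : Function.Bijective (chartFun k i j) :=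
  (awayToSection_bijective k lineWeight (X_mem_grading k lineWeight i) one_pos).comp
    ⟨linePoly_injective k hij, linePoly_surjective k hij⟩

theorem chartFun_C (i j : Fin 2) (c : k) : chartFun k i j (C c) =
    (Line.toSpec k).appLE ⊤ (WProj.chart k lineWeight i) (le_preimage_top _ _)
      ((Scheme.ΓSpecIso (CommRingCat.of k)).inv c) := by
  rw [chartFun, RingHom.comp_apply, linePoly_C]
  exact (toSpec_appLE k lineWeight (X_mem_grading k lineWeight i) one_pos c).symm

theorem basicOpen_chartFun_X (i j : Fin 2) : (Line k).basicOpen (chartFun k i j X) =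
    WProj.chart k lineWeight i ⊓ WProj.chart k lineWeight j := by
  rw [← basicOpen_awayToSection k lineWeight (X_mem_grading k lineWeight i) one_pos
    (X_mem_grading k lineWeight j) one_pos, chartFun, RingHom.comp_apply, linePoly_X]
  congr 2
  apply val_injective
  simp [lineFrac, Away.isLocalizationElem]

theorem isAffineOpen_chart (i : Fin 2) : IsAffineOpen (WProj.chart k lineWeight i) :=
  Proj.isAffineOpen_basicOpen _ _ (X_mem_grading k lineWeight i) one_pos

theorem mem_chart_or (x : Line k) :
    x ∈ WProj.chart k lineWeight 0 ∨ x ∈ WProj.chart k lineWeight 1 := by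
  have h := Proj.iSup_basicOpen_eq_top' (grading k lineWeight)
    (fun i : Fin 2 => (MvPolynomial.X i : MvPolynomial (Fin 2) k))
    (fun i => ⟨1, X_mem_grading k lineWeight i⟩) (by
      rw [eq_top_iff]
      rintro P -
      induction P using MvPolynomial.induction_on with
      | C c =>
        exact (Algebra.adjoin (grading k lineWeight 0) _).algebraMap_mem
          (algebraMap k (grading k lineWeight 0) c)
      | add P Q hP hQ => exact add_mem hP hQ
      | mul_X P i hP => exact mul_mem hP (Algebra.subset_adjoin ⟨i, rfl⟩))
  have hx : x ∈ (⊤ : (Line k).Opens) := trivial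
  rw [← h, TopologicalSpace.Opens.mem_iSup] at hx
  obtain ⟨i, hi⟩ := hx
  fin_cases i
  · exact Or.inl hi
  · exact Or.inr hi

theorem res_res {X : Scheme.{u}} {U V W : X.Opens} (h : V ≤ U) (h' : W ≤ V) (a : Γ(X, U)) :
    X.presheaf.map (homOfLE h').op (X.presheaf.map (homOfLE h).op a) =
      X.presheaf.map (homOfLE (h'.trans h)).op a := by
  rw [← CommRingCat.comp_apply, ← Functor.map_comp]
  rfl

theorem res_chartFun_X_mul (V : (Line k).Opens) (h0 : V ≤ WProj.chart k lineWeight 0)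
    (h1 : V ≤ WProj.chart k lineWeight 1) :
    (Line k).presheaf.map (homOfLE h0).op (chartFun k 0 1 X) *
      (Line k).presheaf.map (homOfLE h1).op (chartFun k 1 0 X) = 1 := by
  have hB : Proj.basicOpen (grading k lineWeight) (MvPolynomial.X 0 * MvPolynomial.X 1) =
      WProj.chart k lineWeight 0 ⊓ WProj.chart k lineWeight 1 := Proj.basicOpen_mul _ _ _
  have hV := (le_inf h0 h1).trans_eq hB.symm
  rw [← res_res (hB.trans_le inf_le_left) hV, ← res_res (hB.trans_le inf_le_right) hV,
    chartFun, chartFun, RingHom.comp_apply, RingHom.comp_apply, linePoly_X, linePoly_X, lineFrac,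
    lineFrac]
  have e0 := res_awayToSection k lineWeight (X_mem_grading k lineWeight 1)
    (rfl : (MvPolynomial.X 0 * MvPolynomial.X 1 : MvPolynomial (Fin 2) k) = _)
    (hB.trans_le inf_le_left)
  have e1 := res_awayToSection k lineWeight (X_mem_grading k lineWeight 0)
    (mul_comm (MvPolynomial.X 0) (MvPolynomial.X 1) : (_ : MvPolynomial (Fin 2) k) = _)
    (hB.trans_le inf_le_right)
  rw [e0, e1, ← map_mul, ← map_mul]
  refine (congrArg _ ((congrArg _ ?_).trans
    (map_one (Proj.awayToSection (grading k lineWeight) _).hom))).trans (map_one _)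
  rw [awayMap_mk, awayMap_mk]
  apply val_injective
  rw [val_mul, Away.val_mk, Away.val_mk, val_one, Localization.mk_mul, ← Localization.mk_one,
    Localization.mk_eq_mk_iff, Localization.r_iff_exists]
  refine ⟨1, ?_⟩
  simp
  ring

theorem res_chartFun_C (c : k) (V : (Line k).Opens) (h0 : V ≤ WProj.chart k lineWeight 0)
    (h1 : V ≤ WProj.chart k lineWeight 1) :
    (Line k).presheaf.map (homOfLE h0).op (chartFun k 0 1 (C c)) =
      (Line k).presheaf.map (homOfLE h1).op (chartFun k 1 0 (C c)) := by
  have key : ∀ (i : Fin 2) (h : V ≤ WProj.chart k lineWeight i) (y : Γ(Spec (CommRingCat.of k), ⊤)),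
      (Line k).presheaf.map (homOfLE h).op
        ((Line.toSpec k).appLE ⊤ (WProj.chart k lineWeight i) (le_preimage_top _ _) y) =
      (Line.toSpec k).appLE ⊤ V (le_preimage_top _ _) y := fun i h y =>
    congr($(Scheme.Hom.appLE_map (Line.toSpec k) (le_preimage_top _ _) (homOfLE h).op) y)
  rw [chartFun_C, chartFun_C, key, key]

/-- With `s = 1 / t` this is `s ^ deg P * P(t)`: the pole of `P` at infinity has order `deg P`. -/
theorem res_chartFun_reverse (P : k[X]) (V : (Line k).Opens) (h0 : V ≤ WProj.chart k lineWeight 0)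
    (h1 : V ≤ WProj.chart k lineWeight 1) :
    (Line k).presheaf.map (homOfLE h0).op (chartFun k 0 1 P.reverse) =
      (Line k).presheaf.map (homOfLE h0).op (chartFun k 0 1 X) ^ P.natDegree *
      (Line k).presheaf.map (homOfLE h1).op (chartFun k 1 0 P) := by
  have hX := res_chartFun_X_mul k V h0 h1
  let φ0 := ((Line k).presheaf.map (homOfLE h0).op).hom.comp (chartFun k 0 1)
  let φ1 := ((Line k).presheaf.map (homOfLE h1).op).hom.comp (chartFun k 1 0)
  have hφ : φ0.comp C = φ1.comp C := RingHom.ext fun c => res_chartFun_C k c V h0 h1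
  have e : ∀ (φ : k[X] →+* Γ(Line k, V)) (Q : k[X]), φ Q = Q.eval₂ (φ.comp C) (φ X) :=
    fun φ Q => by
      conv_rhs => rw [← hom_eval₂, eval₂_C_X]
  change φ0 X * φ1 X = 1 at hX
  change φ0 P.reverse = φ0 X ^ P.natDegree * φ1 P
  let : Invertible (φ1 X) := ⟨φ0 X, hX, by rw [mul_comm, hX]⟩
  have h := eval₂_reverse_mul_pow (φ0.comp C) (φ1 X) P
  rw [show ⅟(φ1 X) = φ0 X from rfl, ← e φ0, hφ, ← e φ1] at h
  rw [← h, mul_comm, mul_assoc, ← mul_pow, mul_comm (φ1 X), hX, one_pow, mul_one]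


end Sections

/-! ### Relations among the `U_i` and the boundary equation -/

noncomputable section Functions

variable (k : Type u) [Field k] (p : ℕ)

theorem U_mul_U {i j i' j' : Fin (p + 1)} (h : (i : ℕ) + j = i' + j') :
    U k p i * U k p j = U k p i' * U k p j' := by
  rw [U, U, U, U, ← map_mul, ← map_mul]
  congr 1
  apply val_injective
  simp only [val_mul, Away.val_mk, Localization.mk_mul]
  congr 1
  have := i.2
  have := j.2
  have := i'.2
  have := j'.2
  have e0 : p - (i : ℕ) + (p - (j : ℕ)) = p - (i' : ℕ) + (p - (j' : ℕ)) := by omega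
  calc _ = (MvPolynomial.X 0 ^ (p - (i : ℕ) + (p - (j : ℕ))) * MvPolynomial.X 1 ^ ((i : ℕ) + j) :
        MvPolynomial (Fin 3) k) := by rw [pow_add, pow_add]; ring
    _ = _ := by rw [e0, h, pow_add, pow_add]; ring

theorem U_pow (i : Fin (p + 1)) :
    U k p i ^ p = U k p 0 ^ (p - (i : ℕ)) * U k p (Fin.last p) ^ (i : ℕ) := by
  rw [U, U, U, ← map_pow, ← map_pow, ← map_pow, ← map_mul]
  congr 1
  apply val_injective
  simp only [val_mul, val_pow, Away.val_mk, Localization.mk_mul, Localization.mk_pow]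
  have hi : (i : ℕ) ≤ p := Nat.lt_succ_iff.mp i.2
  congr 1
  · simp only [Fin.val_zero, Fin.val_last, Nat.sub_zero, Nat.sub_self, pow_zero, mul_one, one_mul]
    rw [mul_pow, ← pow_mul, ← pow_mul, ← pow_mul, ← pow_mul, mul_comm p (p - _), mul_comm p (i : ℕ)]
  · rw [← pow_add, Nat.sub_add_cancel hi]

theorem fraction_num_mem (j : Fin 2) (i : Fin (p + 1)) :
    (MvPolynomial.X 0 ^ (p - (i : ℕ)) * MvPolynomial.X 1 ^ (i : ℕ) : MvPolynomial (Fin 3) k) ∈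
      grading k (zWeight p) (p • zWeight p j.castSucc) := by
  have h := U_num_mem k p i
  fin_cases j <;> simpa [zWeight] using h

/-- The function `z_0 ^ (p - i) z_1 ^ i / z_j ^ p` on the chart `D₊(z_j)`. -/
def fraction (j : Fin 2) (i : Fin (p + 1)) :
    Γ(ZBar k p, WProj.chart k (zWeight p) j.castSucc) :=
  (Proj.awayToSection (grading k (zWeight p)) (MvPolynomial.X j.castSucc)).hom
    (Away.mk (grading k (zWeight p)) (X_mem_grading k (zWeight p) j.castSucc) p
      (MvPolynomial.X 0 ^ (p - (i : ℕ)) * MvPolynomial.X 1 ^ (i : ℕ)) (fraction_num_mem k p j i))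

theorem fraction_zero : fraction k p 0 0 = 1 := by
  refine (congrArg (Proj.awayToSection (grading k (zWeight p)) _).hom ?_).trans (map_one _)
  apply val_injective
  rw [Away.val_mk, val_one, ← Localization.mk_one, Localization.mk_eq_mk_iff,
    Localization.r_iff_exists]
  exact ⟨1, by simp⟩

theorem fraction_last : fraction k p 1 (Fin.last p) = 1 := by
  refine (congrArg (Proj.awayToSection (grading k (zWeight p)) _).hom ?_).trans (map_one _)
  apply val_injective
  rw [Away.val_mk, val_one, ← Localization.mk_one, Localization.mk_eq_mk_iff,
    Localization.r_iff_exists]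
  exact ⟨1, by simp⟩

/-- The boundary equation clears the pole of `U_i` along `Δ_Z`; this is what links contact order to
the degrees of the `f^* U_i`. -/
theorem res_U_mul_boundaryEq (j : Fin 2) (i : Fin (p + 1)) {V : (ZBar k p).Opens}
    (h2 : V ≤ ZOpen k p) (hj : V ≤ WProj.chart k (zWeight p) j.castSucc) :
    (ZBar k p).presheaf.map (homOfLE h2).op (U k p i) *
      (ZBar k p).presheaf.map (homOfLE hj).op (boundaryEq k p j) =
      (ZBar k p).presheaf.map (homOfLE hj).op (fraction k p j i) := by
  have hB : Proj.basicOpen (grading k (zWeight p)) (MvPolynomial.X j.castSucc * MvPolynomial.X 2) =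
      WProj.chart k (zWeight p) j.castSucc ⊓ ZOpen k p := Proj.basicOpen_mul _ _ _
  have hV := (le_inf hj h2).trans_eq hB.symm
  rw [← res_res (hB.trans_le inf_le_left) hV, ← res_res (hB.trans_le inf_le_right) hV,
    ← res_res (hB.trans_le inf_le_left) hV, U, boundaryEq, fraction]
  have ej := res_awayToSection k (zWeight p) (X_mem_grading k (zWeight p) 2)
    (rfl : (MvPolynomial.X j.castSucc * MvPolynomial.X 2 : MvPolynomial (Fin 3) k) = _)
    (hB.trans_le inf_le_left)
  have e2 := res_awayToSection k (zWeight p) (X_mem_grading k (zWeight p) j.castSucc)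
    (mul_comm (MvPolynomial.X j.castSucc) (MvPolynomial.X 2) : (_ : MvPolynomial (Fin 3) k) = _)
    (hB.trans_le inf_le_right)
  rw [ej, ej, e2, ← map_mul, ← map_mul]
  refine congrArg _ (congrArg _ ?_)
  rw [awayMap_mk, awayMap_mk, awayMap_mk]
  apply val_injective
  rw [val_mul, Away.val_mk, Away.val_mk, Away.val_mk, Localization.mk_mul,
    Localization.mk_eq_mk_iff, Localization.r_iff_exists]
  refine ⟨1, ?_⟩
  simp
  ring

end Functions

/-! ### The polynomials attached to a curve -/

noncomputable section CurvePoly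

variable {k : Type u} [Field k] {p : ℕ}

theorem polyFun_bijective : Function.Bijective (polyFun k) :=
  chartFun_bijective k (by decide : (1 : Fin 2) ≠ 0)

/-- The isomorphism `k[t] ≅ Γ(𝔸¹, 𝒪)`. -/
def polyEquiv (k : Type u) [Field k] : k[X] ≃+* Γ(Line k, affineLine k) :=
  RingEquiv.ofBijective (polyFun k) polyFun_bijective

/-- The polynomial `f^* U_i`. -/
def Curve.poly (f : Curve k p) (i : ℕ) : k[X] :=
  -- The index wraps modulo `p + 1`, so only `i ≤ p` is meaningful.
  (polyEquiv k).symm (f.pullback (U k p (Fin.ofNat (p + 1) i)))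

theorem ofNat_eq {i : ℕ} (hi : i < p + 1) : Fin.ofNat (p + 1) i = ⟨i, hi⟩ :=
  Fin.ext (Nat.mod_eq_of_lt hi)

theorem Curve.polyFun_poly (f : Curve k p) (i : Fin (p + 1)) :
    polyFun k (f.poly i) = f.pullback (U k p i) := by
  rw [poly, ofNat_eq i.2]
  exact (polyEquiv k).apply_symm_apply _

theorem Curve.exists_coprime_factorization (f : Curve k p) (hp : 0 < p) :
    ∃ M V W : k[X], IsCoprime V W ∧ ∀ i ≤ p, f.poly i = M * V ^ (p - i) * W ^ i := by
  refine A1Z.exists_coprime_factorization hp f.poly (fun i hi => ?_) (fun i hi => ?_)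
  · rw [poly, poly, poly, poly, ← map_mul, ← map_mul, ← map_mul, ← map_mul,
      ofNat_eq (i := i) (by omega), ofNat_eq (i := 1) (by omega), ofNat_eq (i := i + 1) (by omega),
      ofNat_eq (i := 0) (by omega), U_mul_U]
    simp
  · simp only [poly, ← map_pow, ← map_mul]
    rw [ofNat_eq (i := i) (by omega), ofNat_eq (i := 0) (by omega),
      ofNat_eq (i := p) (by omega), U_pow]
    rfl

end CurvePoly

/-! ### The local ring at infinity -/

noncomputable section Infinity

variable {k : Type u} [Field k] {x : Line k}

/-- The germ at a point of the chart `D₊(x_0)` of a polynomial in `x_1 / x_0`. -/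
def germAt (hx : x ∈ WProj.chart k lineWeight 0) : k[X] →+* (Line k).presheaf.stalk x :=
  ((Line k).presheaf.germ _ x hx).hom.comp (chartFun k 0 1)

theorem isDomain_chart : IsDomain Γ(Line k, WProj.chart k lineWeight 0) :=
  (RingEquiv.ofBijective (chartFun k 0 1) (chartFun_bijective k (by decide))).isDomain_iff.mp
    inferInstance

/-- The coordinate `x_1 / x_0` is invertible only on the affine line, so at infinity a polynomial in
it is a unit exactly when its constant term is. -/
theorem isUnit_germAt {hx : x ∈ WProj.chart k lineWeight 0} (hx' : x ∉ affineLine k) (P : k[X]) :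
    IsUnit (germAt hx P) ↔ P.coeff 0 ≠ 0 := by
  have hX : ¬ IsUnit (germAt hx X) := by
    intro h
    have := ((Line k).mem_basicOpen (chartFun k 0 1 X) x hx).mpr h
    rw [basicOpen_chartFun_X] at this
    exact hx' this.2
  have hP : germAt hx P = germAt hx X * germAt hx P.divX + germAt hx (C (P.coeff 0)) := by
    rw [← map_mul, ← map_add, X_mul_divX_add]
  constructor
  · intro h h0
    rw [hP, h0, map_zero, map_zero, add_zero] at h
    exact hX (isUnit_of_mul_isUnit_left h)
  · intro h
    rw [hP, ← IsLocalRing.notMem_maximalIdeal]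
    intro hmem
    have h1 : germAt hx (C (P.coeff 0)) ∈ IsLocalRing.maximalIdeal _ :=
      (Ideal.add_mem_iff_right _ (Ideal.mul_mem_right _ _ hX)).mp hmem
    exact h1 (((isUnit_iff_ne_zero.mpr h).map C).map _)

theorem localization_at_principal_prime {A S : Type*} [CommRing A] [IsDomain A] [CommRing S]
    [IsLocalRing S] [Algebra A S] (q : Ideal A) [q.IsPrime] [IsLocalization.AtPrime S q] {s : A}
    (hs : s ≠ 0) (hq : q = Ideal.span {s}) :
    IsDomain S ∧ algebraMap A S s ≠ 0 ∧
      IsLocalRing.maximalIdeal S = Ideal.span {algebraMap A S s} := by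
  have hle := q.primeCompl_le_nonZeroDivisors
  refine ⟨IsLocalization.isDomain_of_le_nonZeroDivisors _ hle, ?_, ?_⟩
  · rw [Ne, map_eq_zero_iff _ (IsLocalization.injective S hle)]
    exact hs
  · rw [← IsLocalization.AtPrime.map_eq_maximalIdeal q S, hq, Ideal.map_span, Set.image_singleton]

theorem stalk_structure (hx : x ∈ WProj.chart k lineWeight 0) (hx' : x ∉ affineLine k) :
    IsDomain ((Line k).presheaf.stalk x) ∧ germAt hx X ≠ 0 ∧
      IsLocalRing.maximalIdeal ((Line k).presheaf.stalk x) = Ideal.span {germAt hx X} := by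
  have hU := isAffineOpen_chart k 0
  have hdom := isDomain_chart (k := k)
  let := TopCat.Presheaf.algebra_section_stalk (Line k).presheaf
    (U := WProj.chart k lineWeight 0) ⟨x, hx⟩
  have hloc := hU.isLocalization_stalk ⟨x, hx⟩
  set q := (hU.primeIdealOf ⟨x, hx⟩).asIdeal with hq
  have hmem : ∀ P, chartFun k 0 1 P ∈ q ↔ P.coeff 0 = 0 := by
    intro P
    rw [← not_iff_not, ← Ne, ← isUnit_germAt (hx := hx) hx']
    exact (IsLocalization.AtPrime.isUnit_to_map_iff ((Line k).presheaf.stalk x) q _).symm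
  have hbij := chartFun_bijective k (show (0 : Fin 2) ≠ 1 by decide)
  refine localization_at_principal_prime q ((map_ne_zero_iff _ hbij.1).mpr X_ne_zero) ?_
  refine le_antisymm (fun a ha => ?_) ?_
  · obtain ⟨P, rfl⟩ := hbij.2 a
    obtain ⟨Q, rfl⟩ := X_dvd_iff.mpr ((hmem P).mp ha)
    rw [map_mul]
    exact Ideal.mul_mem_right _ _ (Ideal.mem_span_singleton_self _)
  · rw [Ideal.span_singleton_le_iff_mem, hmem, coeff_X_zero]

theorem res_appLE {X Y : Scheme.{u}} (f : X ⟶ Y) {U : Y.Opens} {V V' : X.Opens} (e : V ≤ f ⁻¹ᵁ U)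
    (h : V' ≤ V) (a : Γ(Y, U)) :
    X.presheaf.map (homOfLE h).op (f.appLE U V e a) = f.appLE U V' (h.trans e) a :=
  congr($(Scheme.Hom.appLE_map f e (homOfLE h).op) a)

theorem appLE_res {X Y : Scheme.{u}} (f : X ⟶ Y) {U U' : Y.Opens} {V : X.Opens} (h : U' ≤ U)
    (e : V ≤ f ⁻¹ᵁ U') (a : Γ(Y, U)) :
    f.appLE U' V e (Y.presheaf.map (homOfLE h).op a) =
      f.appLE U V (e.trans (f.preimage_mono h)) a :=
  congr($(Scheme.Hom.map_appLE f e (homOfLE h).op) a)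

/-- A section near a point at infinity that vanishes on the affine line has zero germ. -/
theorem germ_eq_zero_of_res_eq_zero (hx : x ∈ WProj.chart k lineWeight 0) (hx' : x ∉ affineLine k)
    {T : (Line k).Opens} (hT : T ≤ WProj.chart k lineWeight 0) (hxT : x ∈ T) (δ : Γ(Line k, T))
    (h : (Line k).presheaf.map (homOfLE (inf_le_left : T ⊓ affineLine k ≤ T)).op δ = 0) :
    (Line k).presheaf.germ T x hxT δ = 0 := by
  obtain ⟨hdom, hne, -⟩ := stalk_structure hx hx'
  have hU := isAffineOpen_chart k 0
  obtain ⟨a, haT, hxa⟩ := hU.exists_basicOpen_le ⟨x, hxT⟩ hx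
  set V := (Line k).basicOpen a
  have hV : IsAffineOpen V := hU.basicOpen a
  have hVU : V ≤ WProj.chart k lineWeight 0 := haT.trans hT
  let s := (Line k).presheaf.map (homOfLE hVU).op (chartFun k 0 1 X)
  let δ' := (Line k).presheaf.map (homOfLE haT).op δ
  have hs : (Line k).basicOpen s ≤ T ⊓ affineLine k := by
    rw [Scheme.basicOpen_res, basicOpen_chartFun_X]
    exact le_inf (inf_le_left.trans haT) (inf_le_right.trans inf_le_right)
  -- A power of `s = x_1 / x_0` kills `δ` near `x`, and the germ of `s` is nonzero in a domain.
  obtain ⟨n, hn⟩ := exists_pow_mul_eq_zero_of_res_basicOpen_eq_zero_of_isAffineOpen (Line k) hV δ' s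
    (by
      change (Line k).presheaf.map (homOfLE _).op ((Line k).presheaf.map (homOfLE _).op δ) = 0
      rw [res_res, ← res_res inf_le_left hs, h, map_zero])
  have hn' := congrArg ((Line k).presheaf.germ V x hxa) hn
  rw [map_mul, map_pow, map_zero] at hn'
  have hgs : (Line k).presheaf.germ V x hxa s = germAt hx X :=
    TopCat.Presheaf.germ_res_apply _ _ _ _ _
  have hgδ : (Line k).presheaf.germ V x hxa δ' = (Line k).presheaf.germ T x hxT δ :=
    TopCat.Presheaf.germ_res_apply _ _ _ _ _
  rw [hgs, hgδ] at hn'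
  exact (mul_eq_zero.mp hn').resolve_left (pow_ne_zero _ hne)

end Infinity

/-! ### Contact order and degrees -/

noncomputable section ContactOrder

variable {k : Type u} [Field k] {p : ℕ}

/-- Pulling back `U_i * boundaryEq = fraction` gives the identity on the affine line near infinity;
it extends to the germ because vanishing there is detected off the point. -/
theorem Curve.germAt_reverse_mul (f : Curve k p) {x : Line k} (hx : x ∈ WProj.chart k lineWeight 0)
    (hx' : x ∉ affineLine k) (j : Fin 2)
    (hj : x ∈ f.hom ⁻¹ᵁ WProj.chart k (zWeight p) j.castSucc) (i : Fin (p + 1)) :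
    germAt hx (f.poly i).reverse *
      (Line k).presheaf.germ _ x hj (f.hom.app _ (boundaryEq k p j)) =
    germAt hx X ^ (f.poly i).natDegree *
      (Line k).presheaf.germ _ x hj (f.hom.app _ (fraction k p j i)) := by
  set W := f.hom ⁻¹ᵁ WProj.chart k (zWeight p) j.castSucc with hW
  set T := W ⊓ WProj.chart k lineWeight 0 with hT
  have hTW : T ≤ W := inf_le_left
  have hT0 : T ≤ WProj.chart k lineWeight 0 := inf_le_right
  have hxT : x ∈ T := ⟨hj, hx⟩
  let res0 : Γ(Line k, WProj.chart k lineWeight 0) →+* Γ(Line k, T) :=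
    ((Line k).presheaf.map (homOfLE hT0).op).hom
  let resW : Γ(Line k, W) →+* Γ(Line k, T) := ((Line k).presheaf.map (homOfLE hTW).op).hom
  have key := germ_eq_zero_of_res_eq_zero hx hx' hT0 hxT
    (res0 (chartFun k 0 1 (f.poly i).reverse) * resW (f.hom.app _ (boundaryEq k p j)) -
      res0 (chartFun k 0 1 X) ^ (f.poly i).natDegree * resW (f.hom.app _ (fraction k p j i))) ?_
  · rw [map_sub, map_mul, map_mul, map_pow, sub_eq_zero] at key
    have e0 : ∀ a, (Line k).presheaf.germ T x hxT (res0 a) = (Line k).presheaf.germ _ x hx a :=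
      fun a => TopCat.Presheaf.germ_res_apply _ _ _ _ _
    have eW : ∀ a, (Line k).presheaf.germ T x hxT (resW a) = (Line k).presheaf.germ _ x hj a :=
      fun a => TopCat.Presheaf.germ_res_apply _ _ _ _ _
    rw [e0, e0, eW, eW] at key
    exact key
  · set T' := T ⊓ affineLine k with hT'
    have h0 : T' ≤ WProj.chart k lineWeight 0 := inf_le_left.trans hT0
    have h1 : T' ≤ affineLine k := inf_le_right
    have hTW' : T' ≤ W := inf_le_left.trans hTW
    rw [map_sub, map_mul, map_mul, map_pow, sub_eq_zero]
    change (Line k).presheaf.map (homOfLE _).op ((Line k).presheaf.map (homOfLE hT0).op _) *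
      (Line k).presheaf.map (homOfLE _).op ((Line k).presheaf.map (homOfLE hTW).op _) =
      (Line k).presheaf.map (homOfLE _).op ((Line k).presheaf.map (homOfLE hT0).op _) ^ _ *
      (Line k).presheaf.map (homOfLE _).op ((Line k).presheaf.map (homOfLE hTW).op _)
    rw [res_res, res_res, res_res, res_res, res_chartFun_reverse k _ T' h0 h1, mul_assoc]
    congr 1
    have hle : T' ≤ f.hom ⁻¹ᵁ (WProj.chart k (zWeight p) j.castSucc ⊓ ZOpen k p) :=
      le_inf hTW' (h1.trans f.preimage.ge)
    have hrel := congrArg (f.hom.appLE _ T' hle)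
      (res_U_mul_boundaryEq k p j i (V := WProj.chart k (zWeight p) j.castSucc ⊓ ZOpen k p)
        inf_le_right inf_le_left)
    rw [map_mul, appLE_res, appLE_res, appLE_res] at hrel
    rw [← polyFun_eq, f.polyFun_poly, Curve.pullback, Scheme.Hom.app_eq_appLE]
    refine Eq.trans (congrArg₂ (· * ·) (res_appLE _ _ _ _) (res_appLE _ _ _ _)) (hrel.trans ?_)
    exact (res_appLE _ _ _ _).symm

/-- The germ of a nonzero reversed polynomial is a unit, its constant term being a leading
coefficient. Comparing powers of the uniformizer bounds the degree by `d`, with equality where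
`fraction` is `1`: at `i = 0` or `i = p`, depending on the chart. -/
theorem Curve.HasContactOrder.natDegree_poly {f : Curve k p} {d : ℕ} (h : f.HasContactOrder d) :
    (∀ i ≤ p, (f.poly i).natDegree ≤ d) ∧
      ((f.poly 0).natDegree = d ∨ (f.poly p).natDegree = d) := by
  obtain ⟨x, hx', j, hj, hspan⟩ := h
  have hx := (mem_chart_or k x).resolve_right hx'
  obtain ⟨hdom, hne, hmax⟩ := stalk_structure hx hx'
  have hnu : ¬ IsUnit (germAt hx X) := by simp [isUnit_germAt hx']
  have hrel := f.germAt_reverse_mul hx hx' j hj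
  rw [hmax, Ideal.span_singleton_pow, Ideal.span_singleton_eq_span_singleton] at hspan
  have hunit : ∀ P : k[X], P ≠ 0 → IsUnit (germAt hx P.reverse) := fun P hP => by
    rw [isUnit_germAt hx', coeff_zero_reverse]
    exact leadingCoeff_ne_zero.mpr hP
  constructor
  · intro i hi
    by_cases h0 : f.poly i = 0
    · simp [h0]
    have h1 := hrel ⟨i, Nat.lt_succ_of_le hi⟩
    have h2 : germAt hx X ^ (f.poly i).natDegree ∣ germAt hx X ^ d :=
      (((hunit _ h0).dvd_mul_left).mp ⟨_, h1⟩).trans hspan.dvd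
    exact (pow_dvd_pow_iff hne hnu).mp h2
  · have key : ∀ i : Fin (p + 1), fraction k p j i = 1 → (f.poly i).natDegree = d := by
      intro i hi
      have h1 := hrel i
      rw [hi, map_one, map_one, mul_one] at h1
      have h0 : f.poly i ≠ 0 := by
        intro h0
        rw [h0] at h1
        simp at h1
      have h2 : Associated (germAt hx X ^ (f.poly i).natDegree) (germAt hx X ^ d) := by
        refine Associated.trans ?_ hspan
        rw [← h1]
        exact (associated_unit_mul_left _ _ (hunit _ h0))
      exact le_antisymm ((pow_dvd_pow_iff hne hnu).mp h2.dvd)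
        ((pow_dvd_pow_iff hne hnu).mp h2.symm.dvd)
    fin_cases j
    · exact Or.inl (key 0 (fraction_zero k p))
    · exact Or.inr (key (Fin.last p) (fraction_last k p))

end ContactOrder

/-! ### Multiplicity as the degree of the common factor -/

noncomputable section Multiplicity

variable {k : Type u} [Field k] {p : ℕ}

/-- Length is additive over products, and each linear factor has a simple quotient. -/
theorem ord_polynomial [IsAlgClosed k] {A : Type*} [CommRing A] (e : k[X] ≃+* A) {M : k[X]}
    (hM : M ≠ 0) : Ring.ord A (e M) = M.natDegree := by
  have : IsDomain A := e.isDomain_iff.mp inferInstance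
  have hlin : ∀ a, Ring.ord A (e (X - C a)) = 1 := by
    intro a
    have hmax : (Ideal.span {e (X - C a)}).IsMaximal := by
      have := PrincipalIdealRing.isMaximal_of_irreducible (irreducible_X_sub_C a)
      have h2 := Ideal.map_isMaximal_of_equiv e (p := Ideal.span {X - C a})
      rwa [Ideal.map_span, Set.image_singleton] at h2
    rw [Ring.ord, Module.length_eq_one_iff]
    exact isSimpleModule_iff_quot_maximal.mpr ⟨_, hmax, ⟨LinearEquiv.refl _ _⟩⟩
  have hprod : ∀ s : Multiset k, Ring.ord A (e (s.map fun a => X - C a).prod) = s.card := by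
    intro s
    induction s using Multiset.induction_on with
    | empty => simp
    | cons a s ih =>
      rw [Multiset.map_cons, Multiset.prod_cons, map_mul, Ring.ord_mul, ih, hlin,
        Multiset.card_cons, Nat.cast_add, Nat.cast_one, add_comm]
      rw [mem_nonZeroDivisors_iff_ne_zero, map_ne_zero_iff _ e.injective]
      exact (monic_multiset_prod_of_monic _ _ fun a _ => monic_X_sub_C a).ne_zero
  have hroots := C_leadingCoeff_mul_prod_multiset_X_sub_C
    (splits_iff_card_roots.mp (IsAlgClosed.splits M))
  rw [← hroots, map_mul, Ring.ord_mul_of_isUnit_left, hprod, hroots,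
    splits_iff_card_roots.mp (IsAlgClosed.splits M)]
  exact ((isUnit_iff_ne_zero.mpr (leadingCoeff_ne_zero.mpr hM)).map C).map e

theorem Curve.map_strIdeal (f : Curve k p) {M V W : k[X]} (hVW : IsCoprime V W)
    (hu : ∀ i ≤ p, f.poly i = M * V ^ (p - i) * W ^ i) :
    (strIdeal k p).map f.pullback = Ideal.span {polyFun k M} := by
  have hle : ∀ i : Fin (p + 1), (i : ℕ) ≤ p := fun i => Nat.lt_succ_iff.mp i.2
  rw [strIdeal, Ideal.map_span, ← Set.range_comp]
  apply le_antisymm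
  · rw [Ideal.span_le]
    rintro _ ⟨i, rfl⟩
    rw [Function.comp_apply, ← f.polyFun_poly, hu i (hle i), mul_assoc, map_mul]
    exact Ideal.mul_mem_right _ _ (Ideal.mem_span_singleton_self _)
  · rw [Ideal.span_singleton_le_iff_mem]
    -- By Bézout, `u_0 = M V ^ p` and `u_p = M W ^ p` already generate `(M)`.
    obtain ⟨a, b, hab⟩ : IsCoprime (V ^ p) (W ^ p) := hVW.pow
    have h0 := f.polyFun_poly 0
    have hp := f.polyFun_poly (Fin.last p)
    rw [Fin.val_zero, hu 0 (Nat.zero_le _), Nat.sub_zero, pow_zero, mul_one] at h0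
    rw [Fin.val_last, hu p le_rfl, Nat.sub_self, pow_zero, mul_one] at hp
    have : M = a * (M * V ^ p) + b * (M * W ^ p) := by
      calc M = M * (a * V ^ p + b * W ^ p) := by rw [hab, mul_one]
        _ = _ := by ring
    rw [this, map_add, map_mul, map_mul _ b, h0, hp]
    exact add_mem (Ideal.mul_mem_left _ _ (Ideal.subset_span ⟨_, rfl⟩))
      (Ideal.mul_mem_left _ _ (Ideal.subset_span ⟨_, rfl⟩))

theorem Curve.hasForm_of_multiplicity [IsAlgClosed k] (hp : 0 < p) (f : Curve k p) {d m : ℕ}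
    (hd : 0 < d) (hf : f.HasContactOrder d) (hm : f.multiplicity = m) :
    HasForm p m ((d - m) / p) f.poly := by
  obtain ⟨hle, heq⟩ := hf.natDegree_poly
  obtain ⟨M, V, W, hVW, hu⟩ := f.exists_coprime_factorization hp
  have hM : M ≠ 0 := by
    rintro rfl
    rcases heq with h | h
    · simp [hu 0 (Nat.zero_le _)] at h
      omega
    · simp [hu p le_rfl] at h
      omega
  have hdeg : M.natDegree = m := by
    have h1 := ord_polynomial (polyEquiv k) hM
    rw [Curve.multiplicity, f.map_strIdeal hVW hu] at hm
    have h2 := h1.symm.trans hm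
    exact_mod_cast h2
  refine ⟨M, V, W, hdeg.le, ?_, ?_, hu⟩
  · rw [← hdeg]
    refine natDegree_le_of_natDegree_mul_pow_le hp hM ?_
    simpa [hu 0 (Nat.zero_le _)] using hle 0 (Nat.zero_le _)
  · rw [← hdeg]
    refine natDegree_le_of_natDegree_mul_pow_le hp hM ?_
    simpa [hu p le_rfl] using hle p le_rfl

end Multiplicity

/-! ### Invariance under reparametrization -/

noncomputable section Isomorphism

variable {k : Type u} [Field k] {p : ℕ}

theorem appLE_of_eq_id {X : Scheme.{u}} {f : X ⟶ X} (hf : f = 𝟙 X) {U : X.Opens}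
    (e : U ≤ f ⁻¹ᵁ U) (a : Γ(X, U)) : f.appLE U U e a = a := by
  subst hf
  exact congr($(X.presheaf.map_id _) a)

theorem polyFun_C (c : k) : polyFun k (C c) = (Line.toSpec k).appLE ⊤ (affineLine k) (le_preimage_top _ _)
    ((Scheme.ΓSpecIso (CommRingCat.of k)).inv c) :=
  chartFun_C k 1 0 c

theorem appLE_appLE {X Y Z : Scheme.{u}} (f : X ⟶ Y) (g : Y ⟶ Z) {U : Z.Opens} {V : Y.Opens}
    {W : X.Opens} (e₁ : V ≤ g ⁻¹ᵁ U) (e₂ : W ≤ f ⁻¹ᵁ V) (a : Γ(Z, U)) :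
    f.appLE V W e₂ (g.appLE U V e₁ a) = (f ≫ g).appLE U W (e₂.trans (f.preimage_mono e₁)) a :=
  congr($(Scheme.Hom.appLE_comp_appLE f g U V W e₁ e₂) a)

theorem exists_poly_eq_comp {f g : Curve k p} (s : Line k ≅ Line k)
    (h1 : s.hom ≫ Line.toSpec k = Line.toSpec k) (h2 : s.hom ⁻¹ᵁ affineLine k = affineLine k)
    (h3 : s.hom ≫ f.hom = g.hom) :
    ∃ q : k[X], q.natDegree ≤ 1 ∧ ∀ i, g.poly i = (f.poly i).comp q := by
  have h2' : s.inv ⁻¹ᵁ affineLine k = affineLine k := by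
    conv_lhs => rw [← h2]
    rw [← Scheme.Hom.comp_preimage, Iso.inv_hom_id, Scheme.Hom.id_preimage]
  let σ : Γ(Line k, affineLine k) →+* Γ(Line k, affineLine k) :=
    (s.hom.appLE (affineLine k) (affineLine k) h2.ge).hom
  let τ : k[X] →+* k[X] := ((polyEquiv k).symm.toRingHom.comp σ).comp (polyFun k)
  have hτ : ∀ P, polyFun k (τ P) = σ (polyFun k P) := fun P =>
    (polyEquiv k).apply_symm_apply _
  have hτC : ∀ c, τ (C c) = C c := by
    intro c
    apply polyFun_bijective.1
    rw [hτ, polyFun_C]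
    change s.hom.appLE _ _ _ _ = _
    rw [appLE_appLE]
    simp only [h1]
  have hcomp : ∀ P, τ P = P.comp (τ X) := by
    intro P
    have : τ.comp C = C := RingHom.ext hτC
    rw [Polynomial.comp, ← this, ← hom_eval₂, eval₂_C_X]
  refine ⟨τ X, ?_, fun i => ?_⟩
  -- The inverse automorphism gives `P` with `P.comp (τ X) = X`, so the degrees of `P` and `τ X`
  -- multiply to `1`.
  · have hsurj : ∃ P, τ P = X := by
      let y := s.inv.appLE (affineLine k) (affineLine k) h2'.ge (polyFun k X)
      obtain ⟨P, hP⟩ := polyFun_bijective.2 y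
      refine ⟨P, polyFun_bijective.1 ?_⟩
      rw [hτ, hP]
      change s.hom.appLE _ _ _ (s.inv.appLE _ _ _ _) = _
      rw [appLE_appLE]
      exact appLE_of_eq_id s.hom_inv_id _ _
    obtain ⟨P, hP⟩ := hsurj
    rw [hcomp] at hP
    have := congrArg natDegree hP
    rw [natDegree_comp, natDegree_X] at this
    exact (Nat.eq_one_of_mul_eq_one_left this).le
  · rw [← hcomp]
    apply polyFun_bijective.1
    rw [hτ]
    have e : ∀ f : Curve k p, polyFun k (f.poly i) = f.pullback (U k p (Fin.ofNat (p + 1) i)) :=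
      fun f => (polyEquiv k).apply_symm_apply _
    rw [e, e, Curve.pullback, Curve.pullback]
    change _ = s.hom.appLE _ _ _ (f.hom.appLE _ _ _ _)
    rw [appLE_appLE]
    simp only [h3]

theorem hasForm_of_mk_eq {d m e : ℕ} {f g : CurveOfOrder k p d}
    (h : Moduli.mk f = Moduli.mk g) (hf : HasForm p m e f.1.poly) : HasForm p m e g.1.poly := by
  obtain ⟨s, h1, h2, h3⟩ := Quotient.exact h
  obtain ⟨q, hq, hfg⟩ := exists_poly_eq_comp s h1 h2 h3
  exact (hf.comp hq).congr fun i _ => (hfg i).symm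

end Isomorphism

/-! ### Families and closedness in the moduli space -/

noncomputable section Families

variable {k : Type u} [Field k] {p : ℕ}

/-- The universal property gives a map from `D` to `S` whose composite with the inclusion is the
identity. -/
theorem surjective_of_isPushout {A B C D : CommRingCat.{u}} {f : A ⟶ B} {g : A ⟶ C} {l : B ⟶ D}
    {r : C ⟶ D} (h : IsPushout f g l r) (S : Subring D) (hl : ∀ b, l b ∈ S) (hr : ∀ c, r c ∈ S) :
    S = ⊤ := by
  let l' : B ⟶ CommRingCat.of S := CommRingCat.ofHom (l.hom.codRestrict S hl)
  let r' : C ⟶ CommRingCat.of S := CommRingCat.ofHom (r.hom.codRestrict S hr)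
  have hw : f ≫ l' = g ≫ r' := by
    exact CommRingCat.hom_ext (RingHom.ext fun a => Subtype.ext congr($(h.w) a))
  let ι : CommRingCat.of S ⟶ D := CommRingCat.ofHom S.subtype
  have hid : h.desc l' r' hw ≫ ι = 𝟙 D := by
    apply h.hom_ext
    · rw [h.inl_desc_assoc, Category.comp_id]
      rfl
    · rw [h.inr_desc_assoc, Category.comp_id]
      rfl
  rw [eq_top_iff]
  rintro y -
  have := congr($hid y)
  change ι (h.desc l' r' hw y) = y at this
  rw [← this]
  exact (h.desc l' r' hw y).2

variable (F : Family k p)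

/-- The projection `ℙ¹ × Spec R → ℙ¹`. -/
abbrev Family.fst : Limits.pullback (Line.toSpec k)
    (Spec.map (CommRingCat.ofHom (algebraMap k F.R))) ⟶ Line k :=
  Limits.pullback.fst _ _

/-- The projection `ℙ¹ × Spec R → Spec R`. -/
abbrev Family.snd : Limits.pullback (Line.toSpec k)
    (Spec.map (CommRingCat.ofHom (algebraMap k F.R))) ⟶ Spec (CommRingCat.of F.R) :=
  Limits.pullback.snd _ _

/-- The preimage `𝔸¹ × Spec R` of the affine line in the total space of a family. -/
abbrev Family.affine : (Limits.pullback (Line.toSpec k)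
    (Spec.map (CommRingCat.ofHom (algebraMap k F.R)))).Opens :=
  F.fst ⁻¹ᵁ affineLine k

/-- Polynomials over the base of a family as functions on the family of affine lines. -/
def Family.polyFun : F.R[X] →+* Γ(Limits.pullback (Line.toSpec k)
    (Spec.map (CommRingCat.ofHom (algebraMap k F.R))), F.affine) :=
  eval₂RingHom
    ((Scheme.ΓSpecIso (CommRingCat.of F.R)).inv ≫
      F.snd.appLE
        ⊤ F.affine (le_preimage_top _ _)).hom
    (F.fst.appLE
        (affineLine k) F.affine le_rfl (A1Z.polyFun k X))

theorem Family.polyFun_C (r : F.R) : F.polyFun (C r) =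
    F.snd.appLE
        ⊤ F.affine (le_preimage_top _ _) ((Scheme.ΓSpecIso (CommRingCat.of F.R)).inv r) := by
  simp [Family.polyFun]

theorem Family.polyFun_X : F.polyFun X =
    F.fst.appLE
        (affineLine k) F.affine le_rfl (A1Z.polyFun k X) := by
  simp [Family.polyFun]

theorem SpecMap_appLE_ΓSpecIso_inv {X : Scheme.{u}} {A B : CommRingCat.{u}} (g : X ⟶ Spec B)
    (φ : A ⟶ B) (V : X.Opens) (a : A) :
    (g ≫ Spec.map φ).appLE ⊤ V (le_preimage_top _ _) ((Scheme.ΓSpecIso A).inv a) =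
      g.appLE ⊤ V (le_preimage_top _ _) ((Scheme.ΓSpecIso B).inv (φ a)) := by
  have h := congr($(Scheme.ΓSpecIso_inv_naturality φ) a)
  have h' : (Scheme.ΓSpecIso B).inv (φ a) =
      (Spec.map φ).appLE ⊤ ⊤ (le_preimage_top _ _) ((Scheme.ΓSpecIso A).inv a) :=
    h.trans (congrArg (fun ψ : Γ(Spec A, ⊤) ⟶ Γ(Spec B, ⊤) => ψ ((Scheme.ΓSpecIso A).inv a))
      (Spec.map φ).app_eq_appLE)
  rw [h', appLE_appLE]

/-- Functions on `𝔸¹ × Spec R` form the pushout of `k[t]` and `R` over `k`, and both factors lie in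
the range. -/
theorem Family.polyFun_surjective : Function.Surjective F.polyFun := by
  have hpb := IsPullback.of_hasPullback (Line.toSpec k)
    (Spec.map (CommRingCat.ofHom (algebraMap k F.R)))
  have hUY : F.affine = F.fst ⁻¹ᵁ affineLine k ⊓
      F.snd ⁻¹ᵁ ⊤ := by simp
  have hiso := isIso_pushoutSection_of_isAffineOpen hpb (US := ⊤) (UT := ⊤) (UX := affineLine k)
    (le_preimage_top _ _) (le_preimage_top _ _) hUY (isAffineOpen_top _) (isAffineOpen_top _) (isAffineOpen_chart k 1)
  have hpo := (isIso_pushoutSection_iff hpb (US := ⊤) (UT := ⊤) (UX := affineLine k)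
    (le_preimage_top _ _) (le_preimage_top _ _) hUY).mp hiso
  rw [← RingHom.range_eq_top]
  refine surjective_of_isPushout hpo _ (fun b => ?_) (fun c => ?_)
  · obtain ⟨P, rfl⟩ := polyFun_bijective.2 b
    refine ⟨P.map (algebraMap k F.R), ?_⟩
    let φ : k[X] →+* Γ(Limits.pullback (Line.toSpec k)
        (Spec.map (CommRingCat.ofHom (algebraMap k F.R))), F.affine) :=
      (F.fst.appLE
        (affineLine k) F.affine le_rfl).hom.comp (A1Z.polyFun k)
    suffices F.polyFun.comp (mapRingHom (algebraMap k F.R)) = φ from congr($this P)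
    refine ringHom_ext (fun c => ?_) ?_
    · rw [RingHom.comp_apply, coe_mapRingHom, map_C, F.polyFun_C]
      change _ = F.fst.appLE _ _ _ (A1Z.polyFun k (C c))
      rw [A1Z.polyFun_C, appLE_appLE]
      have := SpecMap_appLE_ΓSpecIso_inv F.snd
        (CommRingCat.ofHom (algebraMap k F.R)) F.affine c
      refine Eq.trans this.symm ?_
      simp only [← Limits.pullback.condition]
    · rw [RingHom.comp_apply, coe_mapRingHom, map_X, F.polyFun_X]
      rfl
  · refine ⟨C ((Scheme.ΓSpecIso (CommRingCat.of F.R)).hom c), ?_⟩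
    rw [F.polyFun_C]
    congr 1
    exact congr($((Scheme.ΓSpecIso (CommRingCat.of F.R)).hom_inv_id) c)

theorem Family.affine_le (a : F.R →ₐ[k] k) : affineLine k ≤ F.incl a ⁻¹ᵁ F.affine := by
  rw [Family.affine, ← Scheme.Hom.comp_preimage, Family.incl, Limits.pullback.lift_fst,
    Scheme.Hom.id_preimage]

theorem Family.incl_polyFun (a : F.R →ₐ[k] k) (P : F.R[X]) :
    (F.incl a).appLE F.affine (affineLine k) (F.affine_le a) (F.polyFun P) =
      A1Z.polyFun k (P.map a.toRingHom) := by
  let φ : F.R[X] →+* Γ(Line k, affineLine k) :=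
    ((F.incl a).appLE F.affine (affineLine k) (F.affine_le a)).hom.comp F.polyFun
  suffices φ = (A1Z.polyFun k).comp (mapRingHom a.toRingHom) from congr($this P)
  refine ringHom_ext (fun r => ?_) ?_
  · rw [RingHom.comp_apply, RingHom.comp_apply, coe_mapRingHom, map_C, F.polyFun_C,
      A1Z.polyFun_C]
    change (F.incl a).appLE _ _ _ _ = _
    rw [appLE_appLE]
    have := SpecMap_appLE_ΓSpecIso_inv (Line.toSpec k) (CommRingCat.ofHom a.toRingHom)
      (affineLine k) r
    refine Eq.trans ?_ this
    simp only [Family.incl, Limits.pullback.lift_snd]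
  · rw [RingHom.comp_apply, RingHom.comp_apply, coe_mapRingHom, map_X, F.polyFun_X]
    change (F.incl a).appLE _ _ _ _ = _
    rw [appLE_appLE]
    exact appLE_of_eq_id (Limits.pullback.lift_fst _ _ _) _ _

theorem Family.exists_poly : ∃ u : ℕ → F.R[X], ∀ (a : F.R →ₐ[k] k) (i : ℕ),
    (F.fibre a).poly i = (u i).map a.toRingHom := by
  choose u hu using fun i : ℕ => F.polyFun_surjective
    (F.hom.appLE (ZOpen k p) F.affine F.preimage.ge (U k p (Fin.ofNat (p + 1) i)))
  refine ⟨u, fun a i => polyFun_bijective.1 ?_⟩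
  rw [← F.incl_polyFun, hu, appLE_appLE]
  exact (polyEquiv k).apply_symm_apply _

theorem Family.isClosed_hasForm [IsAlgClosed k] (m e : ℕ) :
    @IsClosed _ (pointsTopology k F.R) {a | HasForm p m e (F.fibre a).poly} := by
  obtain ⟨u, hu⟩ := F.exists_poly
  let := pointsTopology k F.R
  refine isClosed_of_closure_subset fun a₀ ha₀ => ?_
  -- Being in the closure means that every function vanishing on the locus vanishes at `a₀`.
  rw [closure_induced, ← PrimeSpectrum.zeroLocus_vanishingIdeal_eq_closure] at ha₀
  refine (HasForm.of_mem_closure (u := u) (S := {a | HasForm p m e (F.fibre a).poly})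
    (fun a ha => HasForm.congr ha fun i _ => hu a i) (a₀ := a₀) fun r hr => ?_).congr
    fun i _ => (hu a₀ i).symm
  refine ha₀ (show r ∈ PrimeSpectrum.vanishingIdeal _ from ?_)
  rw [PrimeSpectrum.mem_vanishingIdeal]
  rintro _ ⟨a, ha, rfl⟩
  exact hr a ha

/-- The pullbacks of the functions `U_i` along a curve in the closure of the locus of multiplicity
`m` have the form `M V ^ (p - i) W ^ i`. -/
theorem hasForm_of_mem_stratum [IsAlgClosed k] (hp : 0 < p) {d m : ℕ} (hd : 0 < d)
    {f : CurveOfOrder k p d} (hf : Moduli.mk f ∈ stratum k p d m) :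
    HasForm p m ((d - m) / p) f.1.poly := by
  let S : Set (Moduli k p d) :=
    {x | ∃ g : CurveOfOrder k p d, Moduli.mk g = x ∧ HasForm p m ((d - m) / p) g.1.poly}
  -- Reparametrization invariance makes membership in `S` independent of the representative.
  have hS : ∀ g, Moduli.mk g ∈ S ↔ HasForm p m ((d - m) / p) g.1.poly := fun g =>
    ⟨fun ⟨g', h, hg'⟩ => hasForm_of_mk_eq h hg', fun h => ⟨g, rfl, h⟩⟩
  have hclosed : IsClosed S := by
    rw [instTopologicalSpaceModuli]
    simp only [isClosed_iSup_iff, isClosed_coinduced]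
    intro F hF
    convert F.isClosed_hasForm m ((d - m) / p) using 1
    ext a
    exact hS _
  have hsub : openStratum k p d m ⊆ S := by
    rintro _ ⟨g, rfl, hg⟩
    exact ⟨g, rfl, g.1.hasForm_of_multiplicity hp hd g.2 hg⟩
  exact (hS f).mp (closure_minimal hsub hclosed hf)

end Families

end A1Z

theorem theorem3p6 {k : Type u} [Field k] [IsAlgClosed k] (p : ℕ) [Fact p.Prime] [CharP k p]
    (d m : ℕ) (hd : 0 < d) (hmd : m ≤ d) (hmod : m ≡ d [MOD p])
    (f : A1Z.CurveOfOrder k p d) (hf : A1Z.Moduli.mk f ∈ A1Z.stratum k p d m) :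
    ∃ (a : Fin m → k) (β γ : Fin ((d - m) / p + 1) → k),
      ∀ i : Fin (p + 1),
        f.1.pullback (A1Z.U k p i) =
          A1Z.polyFun k
            ((∏ l, (Polynomial.X + Polynomial.C (a l))) *
              (∑ j, Polynomial.C (β j) * Polynomial.X ^ (j : ℕ)) ^ (p - (i : ℕ)) *
              (∑ j, Polynomial.C (γ j) * Polynomial.X ^ (j : ℕ)) ^ (i : ℕ)) := by
  have hp : 0 < p := (Fact.out : p.Prime).pos
  obtain ⟨a, β, γ, h⟩ := (A1Z.hasForm_of_mem_stratum hp hd hf).eq_prod hp hd hmd hmod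
    f.2.natDegree_poly.2
  exact ⟨a, β, γ, fun i => by rw [← f.1.polyFun_poly, h i (Nat.lt_succ_iff.mp i.2)]⟩
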